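/- A deterministic shared object type $T$ is given by a set of states, a set of operations, a set of responses, and a function that assigns to each state and operation a unique new state and response. It is readable if it has a Read operation that returns the entire state of the object without altering it. Fix a set $V$ of possible inputs with at least two elements. Consider $n$ asynchronous processes that communicate by atomic operations on objects of type $T$ and on read/write registers; any number of objects and registers, possibly infinite, may be used, and the algorithm chooses their initial states. Each process gets an input from $V$. (Wait-free) consensus among $n$ processes is solvable using $T$ and registers if there is an algorithm such that, in every execution in which processes may halt but do not recover: no two outputs produced differ (agreement); each output is the input of some process (validity); and each process that keeps taking steps outputs a value after finitely many of its own steps. Recoverable consensus (RC) among $n$ processes is solvable if there is an algorithm that works in all executions in which, moreover, each process may at any time crash individually and recover, any number of times: a crash resets the process's local state to its initial one (with the same input), so that it begins its code again, and leaves the shared objects and registers unchanged. Here agreement covers all outputs, including those of the same process in different runs of its code, and the last requirement is that a process that executes its code from the beginning either crashes or outputs a value after finitely many of its own steps. Let $cons(T)$ and $rcons(T)$ be the maximum number $n$ of processes among which consensus, respectively RC, is solvable using $T$ and registers, or $\infty$ if there is no maximum. Corollary. Let $T$ be a deterministic, readable type. For every integer $n\ge 2$, if $cons(T)\ge n$,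 then RC among $n-2$ processes is solvable using $T$ and registers. Hence $$cons(T)-2\;\le\; rcons(T)\;\le\; cons(T),$$ where $\infty-2=\infty$. -/

import Mathlib

universe u

namespace RecoverableConsensus

/-- A deterministic shared object type, given by its sequential specification: a set of states, a set
of operations (an operation includes its arguments), a set of responses, and the unique new state and
response that result when an operation is applied to an object that is in a given state. -/
structure DetType where
  State : Type u
  Op : Type u
  Resp : Type u
  apply : State → Op → State × Resp

/-- The type is readable: some operation returns the entire state of the object (the response
determines the state) and does not alter the state. -/
def DetType.Readable (T : DetType.{u}) : Prop :=
  ∃ (read : T.Op) (report : T.State → T.Resp), Function.Injective report ∧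
    ∀ q : T.State, T.apply q read = (q, report q)

/-- What a deterministic program does next: apply an operation to one of the objects of type `T`, read
or write one of the registers (each of these is one atomic step, after which the program continues in
the given local state), or halt with an output value. -/
inductive Action (T : DetType.{u}) (V Obj Reg RegVal Loc : Type u) : Type u
  | invoke (o : Obj) (op : T.Op) (cont : T.Resp → Loc)
  | readReg (r : Reg) (cont : RegVal → Loc)
  | writeReg (r : Reg) (x : RegVal) (cont : Loc)
  | output (v : V)

/-- An algorithm for `n` asynchronous processes with inputs and outputs in `V` that communicate by
objects of type `T` and read/write registers. There may be any number, even infinitely many, of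
objects and registers, and the algorithm chooses their initial states. -/
structure Algorithm (T : DetType.{u}) (V : Type u) (n : ℕ) where
  /-- names of the shared objects of type `T` -/
  Obj : Type u
  /-- names of the registers -/
  Reg : Type u
  /-- values that a register can hold -/
  RegVal : Type u
  /-- local states, including the programme counter -/
  Loc : Type u
  initObj : Obj → T.State
  initReg : Reg → RegVal
  /-- initial local state of a process, depending on its input -/
  start : Fin n → V → Loc
  /-- the code of each process -/
  code : Fin n → Loc → Action T V Obj Reg RegVal Loc

/-- An event of an execution: a process takes a step, or a process crashes (and is ready to recover). -/
inductive Event (n : ℕ) : Type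
  | step (i : Fin n)
  | crash (i : Fin n)

namespace Algorithm

variable {T : DetType.{u}} {V : Type u} {n : ℕ}

/-- A configuration: the states of all shared objects, registers and processes. -/
structure Config (A : Algorithm T V n) where
  obj : A.Obj → T.State
  reg : A.Reg → A.RegVal
  loc : Fin n → A.Loc

/-- The initial configuration for given inputs. -/
def init (A : Algorithm T V n) (inp : Fin n → V) : A.Config where
  obj := A.initObj
  reg := A.initReg
  loc i := A.start i (inp i)

open Classical in
/-- The effect of one event. A step performs the next action of the code of the process (a process that
has output a value does nothing). A crash resets the local state of the process to its initial state,
with the same input, and leaves the shared memory unchanged; the next step of the process, if there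
is one, begins its code again. -/
noncomputable def next (A : Algorithm T V n) (inp : Fin n → V) (C : A.Config) : Event n → A.Config
  | .step i =>
    match A.code i (C.loc i) with
    | .invoke o op cont =>
      { obj := Function.update C.obj o (T.apply (C.obj o) op).1
        reg := C.reg
        loc := Function.update C.loc i (cont (T.apply (C.obj o) op).2) }
    | .readReg r cont =>
      { obj := C.obj
        reg := C.reg
        loc := Function.update C.loc i (cont (C.reg r)) }
    | .writeReg r x cont =>
      { obj := C.obj
        reg := Function.update C.reg r x
        loc := Function.update C.loc i cont }
    | .output _ => C
  | .crash i =>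
    { obj := C.obj
      reg := C.reg
      loc := Function.update C.loc i (A.start i (inp i)) }

/-- The configuration reached from the initial one by a finite sequence of events. -/
noncomputable def run (A : Algorithm T V n) (inp : Fin n → V) (es : List (Event n)) : A.Config :=
  es.foldl (A.next inp) (A.init inp)

/-- Just after the sequence of events `es`, process `i` has output `v` (in its current run). -/
def Outputs (A : Algorithm T V n) (inp : Fin n → V) (es : List (Event n)) (i : Fin n) (v : V) : Prop :=
  A.code i ((A.run inp es).loc i) = .output v

/-- The algorithm is correct in all executions whose events belong to `E`. -/
structure Solves (A : Algorithm T V n) (E : Set (Event n)) : Prop where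
  /-- No two outputs produced at any times of an execution, by the same or by different processes,
  differ. -/
  agreement : ∀ (inp : Fin n → V) (es fs : List (Event n)), (∀ e ∈ es ++ fs, e ∈ E) →
    ∀ (i j : Fin n) (v w : V), A.Outputs inp es i v → A.Outputs inp (es ++ fs) j w → v = w
  /-- Each output is the input of some process. -/
  validity : ∀ (inp : Fin n → V) (es : List (Event n)), (∀ e ∈ es, e ∈ E) →
    ∀ (i : Fin n) (v : V), A.Outputs inp es i v → ∃ j, v = inp j
  /-- In every infinite execution, a process that takes infinitely many steps and does not crash from
  time `t₀` on produces an output at some time `t ≥ t₀`. -/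
  waitFree : ∀ (inp : Fin n → V) (e : ℕ → Event n), (∀ t, e t ∈ E) →
    ∀ (i : Fin n) (t₀ : ℕ), (∀ t, t₀ ≤ t → e t ≠ .crash i) →
      (∀ s, ∃ t, s ≤ t ∧ e t = .step i) →
      ∃ (t : ℕ) (v : V), t₀ ≤ t ∧ A.Outputs inp (List.ofFn fun k : Fin t => e k) i v

end Algorithm

/-- Wait-free consensus with inputs in `V` is solvable among `n` processes using objects of type `T`
and registers, with halting failures only (no crash and recovery events; a halted process just takes
no more steps). -/
def ConsensusSolvable (V : Type u) (T : DetType.{u}) (n : ℕ) : Prop :=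
  ∃ A : Algorithm T V n, A.Solves {e | ∃ i, e = .step i}

/-- Recoverable consensus with inputs in `V` is solvable among `n` processes using objects of type `T`
and registers, with independent crashes and recoveries. -/
def RCSolvable (V : Type u) (T : DetType.{u}) (n : ℕ) : Prop :=
  ∃ A : Algorithm T V n, A.Solves Set.univ

/-- The consensus number: the maximum `n` such that consensus is solvable among `n` processes, or `∞` if
there is no maximum. -/
noncomputable def cons (V : Type u) (T : DetType.{u}) : ℕ∞ :=
  ⨆ (n : ℕ) (_ : ConsensusSolvable V T n), (n : ℕ∞)

/-- The (independent) recoverable consensus number. -/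
noncomputable def rcons (V : Type u) (T : DetType.{u}) : ℕ∞ :=
  ⨆ (n : ℕ) (_ : RCSolvable V T n), (n : ℕ∞)

end RecoverableConsensus

/-! The bridge between the two problems is combinatorial: `Discerning` and `Recording` speak only of
the type, of schedules in which each process acts at most once, and of two teams.

Consensus among `m ≥ 2` processes yields `Discerning` (`Solves.exists_discerning`). By the usual
valency argument there is a critical schedule: bivalent, but univalent after any further step. Two
processes whose next steps lead to different values must be about to access the same object, since
reads are invisible to others, accesses to different places commute, and a write erases an earlier
write to the same register. Hence all processes are about to access one object. The teams are given
by the value to which a process's step leads; if a process could not tell from its response and the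
final state which team moved first, it would decide alike after both schedules.

`Discerning` for `m` processes yields `Recording` for any set of between `2` and `m - 2` processes
(`Discerning.exists_recording`). A process kept in reserve can be appended to two schedules; if
these ended in the same state, it could not tell them apart, so the state alone reveals the first
team. Reserving one process on each side costs two processes. A side that is used up is allowed only
if it is reduced to a single process.

`Recording` yields recoverable consensus by recursion on the set of processes (`exists_solvesOn`):
each team agrees within itself, then the teams compete for one more object (`Tournament`). A process
announces its team's value, reads the object, acts only if the object is in its initial state, and
adopts the announced value of the team that moved first. A recovering process that finds the object
changed does not act again. The danger is a return to the initial state. This happens only after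
team `true` moved first, and only when team `false` is a single process; that process therefore
checks, before it acts, whether team `true` has announced a value, and yields if so.

The upper bound holds because crash-free executions are among those that recoverable consensus must
handle. -/

namespace RecoverableConsensus

/-! ### Discerning and recording teams -/

section Schedules

variable {T : DetType.{u}} {ι κ : Type*}

/-- The state of an object that is in state `q` after the processes in `l` apply their operations. -/
def DetType.after (T : DetType.{u}) (op : ι → T.Op) (q : T.State) (l : List ι) : T.State :=
  l.foldl (fun s i => (T.apply s (op i)).1) q

@[simp] theorem DetType.after_nil (op : ι → T.Op) (q : T.State) : T.after op q [] = q := rfl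

@[simp] theorem DetType.after_append_singleton (op : ι → T.Op) (q : T.State) (l : List ι) (i : ι) :
    T.after op q (l ++ [i]) = (T.apply (T.after op q l) (op i)).1 := by
  simp [DetType.after]

theorem DetType.after_map (op : κ → T.Op) (q : T.State) (f : ι → κ) (l : List ι) :
    T.after op q (l.map f) = T.after (op ∘ f) q l := by
  simp [DetType.after, List.foldl_map]

/-- A schedule without repetitions whose first process satisfies `X`. -/
def Leads (X : ι → Prop) (l : List ι) : Prop :=
  l.Nodup ∧ ∃ i t, l = i :: t ∧ X i

theorem Leads.append_singleton {X : ι → Prop} {l : List ι} (h : Leads X l) {i : ι} (hi : i ∉ l) :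
    Leads X (l ++ [i]) := by
  obtain ⟨hn, j, t, rfl, hj⟩ := h
  refine ⟨?_, j, t ++ [i], rfl, hj⟩
  rw [List.nodup_append]
  simp only [List.mem_cons, not_or] at hi
  refine ⟨hn, List.nodup_singleton i, ?_⟩
  rintro x hx y hy rfl
  simp only [List.mem_singleton] at hy
  subst hy
  simp [hi] at hx

theorem Leads.singleton {X : ι → Prop} {i : ι} (hi : X i) : Leads X [i] :=
  ⟨List.nodup_singleton i, i, [], rfl, hi⟩

/-- The processes that take part in a schedule always find out which team moved first, from the
response to their own operation and the final state. -/
def Discerning (T : DetType.{u}) (A B : ι → Prop) (q₀ : T.State) (op : ι → T.Op) : Prop :=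
  ∀ p s t s' t', Leads A (s ++ p :: t) → Leads B (s' ++ p :: t') →
    (T.apply (T.after op q₀ s) (op p)).2 = (T.apply (T.after op q₀ s') (op p)).2 →
    T.after op q₀ (s ++ p :: t) ≠ T.after op q₀ (s' ++ p :: t')

theorem Discerning.symm {A B : ι → Prop} {q₀ : T.State} {op : ι → T.Op}
    (h : Discerning T A B q₀ op) : Discerning T B A q₀ op :=
  fun p s t s' t' hB hA hr he => h p s' t' s t hA hB hr.symm he.symm

/-- The idle process `p` serves as a witness: appended to both schedules, it would get the same
response and leave the same state. -/
theorem Discerning.after_ne {A B : ι → Prop} {q₀ : T.State} {op : ι → T.Op}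
    (h : Discerning T A B q₀ op) {l l' : List ι} (hl : Leads A l) (hl' : Leads B l') {p : ι}
    (hp : p ∉ l) (hp' : p ∉ l') : T.after op q₀ l ≠ T.after op q₀ l' := by
  intro he
  refine h p l [] l' [] (hl.append_singleton hp) (hl'.append_singleton hp') (by rw [he]) ?_
  simp [he]

/-- If `l` led back to `q₀`, then `b` acting after `l` and `b` acting first would be
indistinguishable to `b`. -/
theorem Discerning.after_ne_self {A B : ι → Prop} {q₀ : T.State} {op : ι → T.Op}
    (h : Discerning T A B q₀ op) {l : List ι} (hl : Leads A l) {b : ι} (hb : B b) (hbl : b ∉ l) :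
    T.after op q₀ l ≠ q₀ := by
  intro he
  refine h b l [] [] [] (hl.append_singleton hbl) (Leads.singleton hb) (by rw [he]; rfl) ?_
  simp only [DetType.after_append_singleton, he, List.nil_append]
  rfl

/-- The processes are split into two nonempty teams such that the state of the object tells which team
moved first; the object never returns to its initial state after the team `false` moved first, and
it does so after the team `true` moved first only if the team `false` is a single process. -/
structure Recording (T : DetType.{u}) (side : ι → Option Bool) (q₀ : T.State) (op : ι → T.Op) :
    Prop where
  separated : ∀ l l', Leads (fun i => side i = some true) l → Leads (fun i => side i = some false) l' →
    (∀ i ∈ l, side i ≠ none) → (∀ i ∈ l', side i ≠ none) → T.after op q₀ l ≠ T.after op q₀ l'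
  no_return : ∀ l, Leads (fun i => side i = some false) l → (∀ i ∈ l, side i ≠ none) →
    T.after op q₀ l ≠ q₀
  single : ∀ l, Leads (fun i => side i = some true) l → (∀ i ∈ l, side i ≠ none) →
    T.after op q₀ l = q₀ → ∀ i j, side i = some false → side j = some false → i = j

theorem Leads.map {X : κ → Prop} {f : ι → κ} {Y : ι → Prop} {P : Set ι} (hf : Set.InjOn f P)
    (hX : ∀ i, Y i → X (f i)) {l : List ι} (hl : Leads Y l) (hP : ∀ i ∈ l, i ∈ P) :
    Leads X (l.map f) := by
  obtain ⟨hn, j, t, rfl, hj⟩ := hl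
  refine ⟨?_, f j, t.map f, rfl, hX _ hj⟩
  exact List.Nodup.map_on (fun x hx y hy h => hf (hP x hx) (hP y hy) h) hn

/-- The processes play roles in `κ` through `f`. The unused role `a` separates the teams and forbids
a return to `q₀` after team `false` led; an unused role `b` forbids it after team `true` led, and
without one the clause `single` must be met directly. -/
theorem Discerning.recording_of_injOn {A B : Finset κ} {q₀ : T.State} {op : κ → T.Op}
    (h : Discerning T (· ∈ A) (· ∈ B) q₀ op) (hAB : Disjoint A B) {side : ι → Option Bool}
    {f : ι → κ} (hf : Set.InjOn f {i | side i ≠ none})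
    (hA : ∀ i, side i = some true → f i ∈ A) (hB : ∀ i, side i = some false → f i ∈ B)
    {a : κ} (ha : a ∈ A) (ha' : ∀ i, side i = some true → f i ≠ a)
    (hb : (∃ b ∈ B, ∀ i, side i = some false → f i ≠ b) ∨
      ∀ i j, side i = some false → side j = some false → i = j) :
    Recording T side q₀ (op ∘ f) := by
  have ha'' : ∀ l : List ι, (∀ i ∈ l, side i ≠ none) → a ∉ l.map f := by
    intro l hl hm
    obtain ⟨i, hi, rfl⟩ := List.mem_map.1 hm
    rcases hs : side i with _ | _ | _
    · exact hl i hi hs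
    · exact Finset.disjoint_left.1 hAB ha (hB i hs)
    · exact ha' i hs rfl
  refine ⟨?_, ?_, ?_⟩
  · intro l l' hl hl' hs hs'
    rw [← DetType.after_map, ← DetType.after_map]
    exact h.after_ne (hl.map hf hA hs) (hl'.map hf hB hs') (ha'' l hs) (ha'' l' hs')
  · intro l hl hs
    rw [← DetType.after_map]
    exact h.symm.after_ne_self (hl.map hf hB hs) ha (ha'' l hs)
  · intro l hl hs he
    rcases hb with ⟨b, hb, hb'⟩ | hb
    · refine absurd he ?_
      rw [← DetType.after_map]
      refine h.after_ne_self (hl.map hf hA hs) hb ?_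
      intro hm
      obtain ⟨i, hi, rfl⟩ := List.mem_map.1 hm
      rcases hs' : side i with _ | _ | _
      · exact hs i hi hs'
      · exact hb' i hs' rfl
      · exact Finset.disjoint_left.1 hAB (hA i hs') hb
    · exact hb

theorem exists_injOn_of_card_le [Nonempty κ] {P : Finset ι} {A : Finset κ} (h : P.card ≤ A.card) :
    ∃ f : ι → κ, Set.InjOn f P ∧ (∀ i ∈ P, f i ∈ A) := by
  obtain ⟨f, hf, hi⟩ := P.finite_toSet.exists_injOn_of_encard_le (t := (A : Set κ))
    (by simpa [Set.encard_coe_eq_coe_finsetCard] using h)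
  exact ⟨f, hi, fun i hi => by simpa using hf hi⟩

theorem Discerning.exists_recording_of_two_le {A B : Finset κ} {q₀ : T.State} {op : κ → T.Op}
    (h : Discerning T (· ∈ A) (· ∈ B) q₀ op) (hAB : Disjoint A B) (hA : 2 ≤ A.card)
    (hB : B.Nonempty) (P : Finset ι) (hP : 2 ≤ P.card) (hP' : P.card + 2 ≤ A.card + B.card) :
    ∃ (side : ι → Option Bool) (op' : ι → T.Op), (∀ i, side i ≠ none ↔ i ∈ P) ∧
      (∀ x, ∃ i, side i = some x) ∧ Recording T side q₀ op' := by
  classical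
  have hB1 := hB.card_pos
  obtain ⟨m, hm1, hmP, hmA, hmB⟩ : ∃ m, 1 ≤ m ∧ m < P.card ∧ m < A.card ∧
      (P.card - m < B.card ∨ P.card - m = 1) := by
    -- Team `true` is as large as possible while it leaves a role of `A` unused and team `false`
    -- nonempty. If `P.card - 1` is the minimum, team `false` is a single process; otherwise `hP'`
    -- leaves a role of `B` unused.
    refine ⟨min (A.card - 1) (P.card - 1), ?_⟩
    omega
  obtain ⟨PA, hPA, hcA⟩ := Finset.exists_subset_card_eq hmP.le
  have hcB : (P \ PA).card = P.card - m := by rw [Finset.card_sdiff_of_subset hPA, hcA]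
  have : Nonempty κ := ⟨hB.choose⟩
  obtain ⟨f, hf, hfA⟩ := exists_injOn_of_card_le (P := PA) (A := A) (by omega)
  obtain ⟨g, hg, hgB⟩ := exists_injOn_of_card_le (P := P \ PA) (A := B) (by omega)
  let side : ι → Option Bool := fun i => if i ∈ PA then some true else if i ∈ P then some false else none
  have st : ∀ i, side i = some true ↔ i ∈ PA := by intro i; simp only [side]; split_ifs <;> simp_all
  have sf : ∀ i, side i = some false ↔ i ∈ P \ PA := by
    intro i; simp only [side, Finset.mem_sdiff]; split_ifs <;> simp_all
  have sn : ∀ i, side i ≠ none ↔ i ∈ P := by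
    intro i; simp only [side]; split_ifs with h1 h2
    · simp [hPA h1]
    · simp [h2]
    · simp [h2]
  let F : ι → κ := fun i => if i ∈ PA then f i else g i
  have Ft : ∀ i, i ∈ PA → F i = f i := fun i hi => if_pos hi
  have Ff : ∀ i, i ∈ P \ PA → F i = g i := fun i hi => if_neg (Finset.mem_sdiff.1 hi).2
  have missing : ∀ {Q : Finset ι} {D : Finset κ}, Q.card < D.card → ∃ d ∈ D, ∀ i ∈ Q, F i ≠ d := by
    intro Q D hc
    obtain ⟨d, hd, hd'⟩ := Finset.exists_mem_notMem_of_card_lt_card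
      (lt_of_le_of_lt (Finset.card_image_le (f := F)) hc)
    exact ⟨d, hd, fun i hi he => hd' (he ▸ Finset.mem_image_of_mem F hi)⟩
  obtain ⟨a, ha, ha'⟩ := missing (Q := PA) (D := A) (by omega)
  refine ⟨side, op ∘ F, sn, ?_, h.recording_of_injOn hAB ?_ ?_ ?_ ha
    (fun i hi => ha' i ((st i).1 hi)) ?_⟩
  · rintro (_ | _)
    · obtain ⟨i, hi⟩ := Finset.card_pos.1 (show 0 < (P \ PA).card by omega)
      exact ⟨i, (sf i).2 hi⟩
    · obtain ⟨i, hi⟩ := Finset.card_pos.1 (show 0 < PA.card by omega)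
      exact ⟨i, (st i).2 hi⟩
  · intro i hi j hj hij
    have hi := (sn i).1 hi
    have hj := (sn j).1 hj
    by_cases h1 : i ∈ PA <;> by_cases h2 : j ∈ PA
    · rw [Ft i h1, Ft j h2] at hij
      exact hf h1 h2 hij
    · have h2 := Finset.mem_sdiff.2 ⟨hj, h2⟩
      rw [Ft i h1, Ff j h2] at hij
      exact absurd (hij ▸ hgB j h2) (Finset.disjoint_left.1 hAB (hfA i h1))
    · have h1 := Finset.mem_sdiff.2 ⟨hi, h1⟩
      rw [Ff i h1, Ft j h2] at hij
      exact absurd (hij ▸ hgB i h1) (Finset.disjoint_left.1 hAB (hfA j h2))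
    · have h1 := Finset.mem_sdiff.2 ⟨hi, h1⟩
      have h2 := Finset.mem_sdiff.2 ⟨hj, h2⟩
      rw [Ff i h1, Ff j h2] at hij
      exact hg h1 h2 hij
  · intro i hi
    rw [Ft i ((st i).1 hi)]
    exact hfA i ((st i).1 hi)
  · intro i hi
    rw [Ff i ((sf i).1 hi)]
    exact hgB i ((sf i).1 hi)
  · rcases hmB with hmB | hmB
    · obtain ⟨b, hb, hb'⟩ := missing (Q := P \ PA) (D := B) (by omega)
      exact .inl ⟨b, hb, fun i hi => hb' i ((sf i).1 hi)⟩
    · right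
      intro i j hi hj
      exact Finset.card_le_one.1 (by omega) i ((sf i).1 hi) j ((sf j).1 hj)

/-- Together `A` and `B` have at least four members, so one of them has at least two and can take
the part of team `true`. -/
theorem Discerning.exists_recording {A B : Finset κ} {q₀ : T.State} {op : κ → T.Op}
    (h : Discerning T (· ∈ A) (· ∈ B) q₀ op) (hAB : Disjoint A B) (hA : A.Nonempty)
    (hB : B.Nonempty) (P : Finset ι) (hP : 2 ≤ P.card) (hP' : P.card + 2 ≤ A.card + B.card) :
    ∃ (side : ι → Option Bool) (op' : ι → T.Op), (∀ i, side i ≠ none ↔ i ∈ P) ∧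
      (∀ x, ∃ i, side i = some x) ∧ Recording T side q₀ op' := by
  have h1 := hA.card_pos
  have h2 := hB.card_pos
  by_cases hc : 2 ≤ A.card
  · exact h.exists_recording_of_two_le hAB hc hB P hP hP'
  · exact h.symm.exists_recording_of_two_le hAB.symm (by omega) hA P hP (by omega)

end Schedules

end RecoverableConsensus

/-! ### Single steps, and recoverable consensus on a subset of the processes -/

namespace RecoverableConsensus

namespace Algorithm

variable {T : DetType.{u}} {V : Type u} {n : ℕ}

section Next

variable (A : Algorithm T V n) (inp : Fin n → V)

open Classical in
theorem next_of_invoke {C : A.Config} {i : Fin n} {o op cont}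
    (h : A.code i (C.loc i) = .invoke o op cont) :
    A.next inp C (.step i) = ⟨Function.update C.obj o (T.apply (C.obj o) op).1, C.reg,
      Function.update C.loc i (cont (T.apply (C.obj o) op).2)⟩ := by
  simp only [next, h]

open Classical in
theorem next_of_readReg {C : A.Config} {i : Fin n} {r cont}
    (h : A.code i (C.loc i) = .readReg r cont) :
    A.next inp C (.step i) = ⟨C.obj, C.reg, Function.update C.loc i (cont (C.reg r))⟩ := by
  simp only [next, h]

open Classical in
theorem next_of_writeReg {C : A.Config} {i : Fin n} {r x cont}
    (h : A.code i (C.loc i) = .writeReg r x cont) :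
    A.next inp C (.step i) =
      ⟨C.obj, Function.update C.reg r x, Function.update C.loc i cont⟩ := by
  simp only [next, h]

theorem next_of_output {C : A.Config} {i : Fin n} {v}
    (h : A.code i (C.loc i) = .output v) : A.next inp C (.step i) = C := by
  simp only [next, h]

open Classical in
theorem next_crash (C : A.Config) (i : Fin n) :
    A.next inp C (.crash i) =
      ⟨C.obj, C.reg, Function.update C.loc i (A.start i (inp i))⟩ := rfl

/-- An event changes the local state of no process but its own. -/
theorem next_loc_of_ne {C : A.Config} {i : Fin n} {e : Event n} (hs : e ≠ .step i)
    (hc : e ≠ .crash i) : (A.next inp C e).loc i = C.loc i := by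
  rcases e with j | j
  · have hij : i ≠ j := fun h => hs (h ▸ rfl)
    rcases h : A.code j (C.loc j) with ⟨o, op, cont⟩ | ⟨r, cont⟩ | ⟨r, x, cont⟩ | v
    · simp [A.next_of_invoke inp h, hij]
    · simp [A.next_of_readReg inp h, hij]
    · simp [A.next_of_writeReg inp h, hij]
    · simp [A.next_of_output inp h]
  · have hij : i ≠ j := fun h => hc (h ▸ rfl)
    simp [next_crash, hij]

@[simp] theorem run_nil : A.run inp [] = A.init inp := rfl

@[simp] theorem run_append_singleton (es : List (Event n)) (e : Event n) :
    A.run inp (es ++ [e]) = A.next inp (A.run inp es) e := by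
  simp [run]

theorem run_ofFn_succ (e : ℕ → Event n) (t : ℕ) :
    A.run inp (List.ofFn fun k : Fin (t + 1) => e k) =
      A.next inp (A.run inp (List.ofFn fun k : Fin t => e k)) (e t) := by
  rw [List.ofFn_succ', List.concat_eq_append, run_append_singleton]
  rfl

end Next

/-- A recoverable consensus algorithm for the processes in `P`; the other processes do nothing. -/
structure SolvesOn (A : Algorithm T V n) (P : Set (Fin n)) : Prop where
  idle : ∀ i ∉ P, ∀ l, ∃ v, A.code i l = .output v
  regVal : Nonempty A.RegVal
  -- One `j` for all prefixes of `es` gives agreement and validity together, and fixes a value for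
  -- the team even before it outputs anything.
  agree : ∀ (inp : Fin n → V) (es : List (Event n)), ∃ j ∈ P, ∀ fs, fs <+: es →
    ∀ i ∈ P, ∀ v, A.Outputs inp fs i v → v = inp j
  waitFree : ∀ (inp : Fin n → V) (e : ℕ → Event n), ∀ i ∈ P, ∀ t₀,
    (∀ t, t₀ ≤ t → e t ≠ .crash i) → (∀ s, ∃ t, s ≤ t ∧ e t = .step i) →
      ∃ (t : ℕ) (v : V), t₀ ≤ t ∧ A.Outputs inp (List.ofFn fun k : Fin t => e k) i v

theorem SolvesOn.solves {A : Algorithm T V n} (h : A.SolvesOn Set.univ) : A.Solves Set.univ where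
  agreement inp es fs _ i j v w hv hw := by
    obtain ⟨k, -, hk⟩ := h.agree inp (es ++ fs)
    rw [hk es (List.prefix_append es fs) i trivial v hv, hk _ (List.prefix_refl _) j trivial w hw]
  validity inp es _ i v hv := by
    obtain ⟨k, -, hk⟩ := h.agree inp es
    exact ⟨k, hk es (List.prefix_refl _) i trivial v hv⟩
  waitFree inp e _ i t₀ hc hs := h.waitFree inp e i trivial t₀ hc hs

/-- Each process outputs its own input at once. -/
def trivial (T : DetType.{u}) (V : Type u) (n : ℕ) : Algorithm T V n where
  Obj := PEmpty
  Reg := PEmpty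
  RegVal := PUnit
  Loc := V
  initObj := PEmpty.elim
  initReg := PEmpty.elim
  start _ v := v
  code _ v := .output v

theorem trivial_outputs (inp : Fin n → V) (es : List (Event n)) (i : Fin n) (v : V) :
    (trivial T V n).Outputs inp es i v ↔ v = inp i := by
  have key : ∀ i, ((trivial T V n).run inp es).loc i = inp i := by
    induction es using List.reverseRecOn with
    | nil => intro i; rfl
    | append_singleton es e ih =>
      intro i
      rw [run_append_singleton]
      rcases e with j | j
      · rw [next_of_output _ _ rfl]
        exact ih i
      · rw [next_crash]
        by_cases hij : i = j
        · subst hij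
          simp only [Function.update_self]
          rfl
        · simpa [hij] using ih i
  rw [← key i]
  refine ⟨fun h => ?_, fun h => ?_⟩
  · injection h with h
    exact h.symm
  · subst h
    rfl

theorem trivial_solvesOn (i : Fin n) : (trivial T V n).SolvesOn {i} where
  idle _ _ l := ⟨l, rfl⟩
  regVal := ⟨PUnit.unit⟩
  agree inp es := by
    refine ⟨i, rfl, ?_⟩
    rintro fs - _ rfl v hv
    exact (trivial_outputs inp fs _ v).1 hv
  waitFree inp e i _ t₀ _ _ := ⟨t₀, inp i, le_rfl, (trivial_outputs inp _ i _).2 rfl⟩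

end Algorithm

theorem rcSolvable_zero (V : Type u) (T : DetType.{u}) : RCSolvable V T 0 :=
  ⟨Algorithm.trivial T V 0, fun _ _ _ _ i => i.elim0, fun _ _ _ i => i.elim0,
    fun _ _ _ i => i.elim0⟩

/-! ### The protocol between two teams and its invariants -/

/-- The place of a process in the protocol by which the two teams agree, after each team has agreed on
a value of its own. -/
inductive Phase (V : Type u) : Type u
  | write
  | look
  | check
  | act
  | relook
  | fetch (x : Bool)
  | done (v : V)

namespace Phase

/-- The number of steps that a process in this phase has still to take, at most. -/
def rank {V : Type u} : Phase V → ℕ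
  | write => 6
  | look => 5
  | check => 4
  | act => 3
  | relook => 2
  | fetch _ => 1
  | done _ => 0

end Phase

open Classical in
/-- In this state of the object, the team `true` moved first. -/
noncomputable def wins (T : DetType.{u}) {ι : Type*} (side : ι → Option Bool) (q₀ : T.State)
    (op : ι → T.Op) (q : T.State) : Bool :=
  decide (∃ l, Leads (fun i => side i = some true) l ∧ (∀ i ∈ l, side i ≠ none) ∧ T.after op q₀ l = q)

open Classical in
/-- What a process of team `x` that sees the state `q` does next. -/
noncomputable def afterLook {V : Type u} {S : Type*} (w : S → Bool) (q₀ : S) (x : Bool) (q : S) :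
    Phase V :=
  if q = q₀ then if x = false ∧ w q₀ = true then .check else .act else .fetch (w q)

/-- The shared memory and the phases of the processes in the protocol between the teams. -/
@[ext] structure View (S V ι : Type*) where
  obj : S
  reg : Bool → Option V
  phase : ι → Phase V

namespace View

section

variable {T : DetType.{u}} {V : Type u} {ι : Type*}

/-- Process `i` of team `x`, whose team agreed on `v`, takes a step. -/
noncomputable def next [DecidableEq ι] (w : T.State → Bool) (q₀ : T.State) (op : ι → T.Op) (d : V) (i : ι)
    (x : Bool) (v : V) (W : View T.State V ι) : View T.State V ι :=
  match W.phase i with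
  | .write => ⟨W.obj, Function.update W.reg x (some v), Function.update W.phase i .look⟩
  | .look => ⟨W.obj, W.reg, Function.update W.phase i (afterLook w q₀ x W.obj)⟩
  | .check => ⟨W.obj, W.reg, Function.update W.phase i ((W.reg true).elim .act .done)⟩
  | .act => ⟨(T.apply W.obj (op i)).1, W.reg, Function.update W.phase i .relook⟩
  | .relook => ⟨W.obj, W.reg, Function.update W.phase i (.fetch (w W.obj))⟩
  | .fetch y => ⟨W.obj, W.reg, Function.update W.phase i (.done ((W.reg y).getD d))⟩
  | .done _ => W

/-- What holds at any time if the team `x` agrees on `a x`. -/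
structure Base (T : DetType.{u}) (side : ι → Option Bool) (q₀ : T.State) (op : ι → T.Op) (a : Bool → V)
    (W : View T.State V ι) : Prop where
  wrote : ∀ i x, side i = some x → W.phase i ≠ .write → W.reg x = some (a x)
  check : ∀ i, W.phase i = .check → side i = some false ∧ wins T side q₀ op q₀ = true
  reg : ∀ y v, W.reg y = some v → v = a y

/-- What holds before one of the teams has won. -/
structure Open (q₀ : T.State) (W : View T.State V ι) : Prop where
  obj : W.obj = q₀
  -- Rank at least `3` says that the process has not passed `act`.
  rank : ∀ i, 3 ≤ (W.phase i).rank

/-- What holds after the team `x` has won, if `l` has accessed the object since it was in its initial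
state for the last time. -/
structure Won (T : DetType.{u}) (side : ι → Option Bool) (q₀ : T.State) (op : ι → T.Op) (a : Bool → V)
    (x : Bool) (l : List ι) (W : View T.State V ι) : Prop where
  reg : W.reg x = some (a x)
  obj : W.obj = T.after op q₀ l
  team : ∀ i ∈ l, side i ≠ none
  notAct : ∀ i ∈ l, W.phase i ≠ .act
  fetch : ∀ i y, W.phase i = .fetch y → y = x
  done : ∀ i v, W.phase i = .done v → v = a x
  check : x = false → ∀ i, W.phase i ≠ .check
  cons : l ≠ [] → W.obj ≠ q₀ ∧ Leads (fun i => side i = some x) l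
  -- The object is in `q₀` although team `true` has won: either it returned there, or the process of
  -- team `false` yielded in phase `check` before any access.
  nil : l = [] → x = true ∧ wins T side q₀ op q₀ = true ∧
    ∀ i, side i = some false → W.phase i ≠ .act

variable {side : ι → Option Bool} {q₀ : T.State} {op : ι → T.Op} {a : Bool → V}
  {W : View T.State V ι}

theorem Base.update [DecidableEq ι] (h : Base T side q₀ op a W) (q : T.State) (i : ι) (p : Phase V)
    (hw : ∀ x, side i = some x → p ≠ .write → W.reg x = some (a x))
    (hc : p = .check → side i = some false ∧ wins T side q₀ op q₀ = true) :
    Base T side q₀ op a ⟨q, W.reg, Function.update W.phase i p⟩ where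
  wrote j x hj hp := by
    by_cases hij : j = i
    · subst hij
      exact hw x hj (by simpa using hp)
    · exact h.wrote j x hj (by simpa [hij] using hp)
  check j hj := by
    by_cases hij : j = i
    · subst hij
      exact hc (by simpa using hj)
    · exact h.check j (by simpa [hij] using hj)
  reg := h.reg

theorem Open.update [DecidableEq ι] (h : Open q₀ W) (reg : Bool → Option V) (i : ι) (p : Phase V)
    (hp : 3 ≤ p.rank) : Open q₀ ⟨W.obj, reg, Function.update W.phase i p⟩ where
  obj := h.obj
  rank j := by
    by_cases hij : j = i
    · subst hij
      simpa using hp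
    · simpa [hij] using h.rank j

theorem Won.update [DecidableEq ι] {x : Bool} {l : List ι} (h : Won T side q₀ op a x l W) (i : ι)
    (p : Phase V) (ha : p = .act → l = [] ∧ side i = some true)
    (hf : ∀ y, p = .fetch y → y = x) (hd : ∀ v, p = .done v → v = a x)
    (hc : x = false → p ≠ .check) :
    Won T side q₀ op a x l ⟨W.obj, W.reg, Function.update W.phase i p⟩ where
  reg := h.reg
  obj := h.obj
  team := h.team
  notAct j hj := by
    by_cases hij : j = i
    · subst hij
      simp only [Function.update_self]
      intro hp
      simp [(ha hp).1] at hj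
    · simpa [hij] using h.notAct j hj
  fetch j y := by
    by_cases hij : j = i
    · subst hij
      simpa using hf y
    · simpa [hij] using h.fetch j y
  done j v := by
    by_cases hij : j = i
    · subst hij
      simpa using hd v
    · simpa [hij] using h.done j v
  check hx j := by
    by_cases hij : j = i
    · subst hij
      simpa using hc hx
    · simpa [hij] using h.check hx j
  cons := h.cons
  nil hl := by
    refine ⟨(h.nil hl).1, (h.nil hl).2.1, fun j hj => ?_⟩
    by_cases hij : j = i
    · subst hij
      simp only [Function.update_self]
      intro hp
      simp [(ha hp).2] at hj
    · simpa [hij] using (h.nil hl).2.2 j hj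

/-- The winner can be determined from the state of the object. -/
theorem Won.wins_eq (hr : Recording T side q₀ op) {x : Bool} {l : List ι}
    (h : Won T side q₀ op a x l W) : wins T side q₀ op W.obj = x := by
  by_cases hl : l = []
  · rw [h.obj, hl, DetType.after_nil, (h.nil hl).1, (h.nil hl).2.1]
  · have hL := (h.cons hl).2
    cases x
    · simp only [wins, decide_eq_false_iff_not]
      rintro ⟨l', hl', hs, he⟩
      exact hr.separated l' l hl' hL hs h.team (he.trans h.obj)
    · simp only [wins, decide_eq_true_eq]
      exact ⟨l, hL, h.team, h.obj.symm⟩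

/-- The access of a process to the object, when its team has won or is just winning. -/
theorem Won.of_act [DecidableEq ι] (hr : Recording T side q₀ op)
    {x : Bool} {l : List ι} {i : ι} (hi : W.phase i = .act) (hl : W.obj = T.after op q₀ l)
    (team : ∀ j ∈ l ++ [i], side j ≠ none) (notAct : ∀ j ∈ l, W.phase j ≠ .act)
    (lead : Leads (fun i => side i = some x) (l ++ [i])) (reg : W.reg x = some (a x))
    (fetch : ∀ i y, W.phase i = .fetch y → y = x)
    (done : ∀ i v, W.phase i = .done v → v = a x)
    (check : x = false → ∀ j, j ≠ i → W.phase j ≠ .check) :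
    ∃ l', Won T side q₀ op a x l' ⟨(T.apply W.obj (op i)).1, W.reg,
      Function.update W.phase i .relook⟩ := by
  have hobj : (T.apply W.obj (op i)).1 = T.after op q₀ (l ++ [i]) := by
    rw [DetType.after_append_singleton, hl]
  have notAct' : ∀ j ∈ l ++ [i], Function.update W.phase i .relook j ≠ .act := by
    intro j hj
    by_cases hij : j = i
    · subst hij
      simp
    · have : j ∈ l := by simpa [hij] using hj
      simpa [hij] using notAct j this
  have fetch' : ∀ j y, Function.update W.phase i .relook j = .fetch y → y = x := by
    intro j y
    by_cases hij : j = i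
    · subst hij
      simp
    · simpa [hij] using fetch j y
  have done' : ∀ j v, Function.update W.phase i .relook j = .done v → v = a x := by
    intro j v
    by_cases hij : j = i
    · subst hij
      simp
    · simpa [hij] using done j v
  have check' : x = false → ∀ j, Function.update W.phase i .relook j ≠ .check := by
    intro hx j
    by_cases hij : j = i
    · subst hij
      simp
    · simpa [hij] using check hx j hij
  -- On a return to `q₀` the recorded history starts afresh as `[]`.
  by_cases hq : T.after op q₀ (l ++ [i]) = q₀
  · have hx : x = true := by
      cases x
      · exact absurd hq (hr.no_return _ lead team)
      · rfl
    subst hx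
    refine ⟨[], reg, hobj.trans hq, by simp, by simp, fetch', done', check', by simp, fun _ =>
      ⟨rfl, ?_, ?_⟩⟩
    · simp only [wins, decide_eq_true_eq]
      exact ⟨_, lead, team, hq⟩
    · intro j hj
      have hmem : j ∈ l ++ [i] := by
        by_contra hj'
        -- Were `j` not in the schedule, appending it would give the same state as `j` acting first,
        -- against the separation of the teams. So `j` has already acted, and it is no longer in
        -- phase `act`.
        refine hr.separated (l ++ [i] ++ [j]) [j] (lead.append_singleton hj') (.singleton hj) ?_ ?_ ?_
        · intro k hk
          rcases List.mem_append.1 hk with hk | hk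
          · exact team k hk
          · simp only [List.mem_singleton] at hk
            simp [hk, hj]
        · simp [hj]
        · rw [DetType.after_append_singleton, hq]
          rfl
      exact notAct' j hmem
  · exact ⟨l ++ [i], reg, hobj, team, notAct', fetch', done', check',
      fun _ => ⟨by rwa [hobj], lead⟩, by simp⟩

/-- The state of the protocol: which team has won, if any. -/
def Status (T : DetType.{u}) (side : ι → Option Bool) (q₀ : T.State) (op : ι → T.Op) (a : Bool → V) :
    Option Bool → View T.State V ι → Prop
  | none, W => Base T side q₀ op a W ∧ Open q₀ W
  | some x, W => Base T side q₀ op a W ∧ ∃ l, Won T side q₀ op a x l W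

theorem Status.base {d : Option Bool} (h : Status T side q₀ op a d W) : Base T side q₀ op a W := by
  cases d <;> exact h.1

theorem Base.next [DecidableEq ι] (hb : Base T side q₀ op a W) (d : V) {i : ι}
    {x : Bool} (hi : side i = some x) :
    Base T side q₀ op a (W.next (wins T side q₀ op) q₀ op d i x (a x)) := by
  have wrote : W.phase i ≠ .write → ∀ y, side i = some y → W.reg y = some (a y) :=
    fun h y hy => hb.wrote i y hy h
  unfold View.next
  rcases hp : W.phase i with _ | _ | _ | _ | _ | y | v
  · have hb' : Base T side q₀ op a ⟨W.obj, Function.update W.reg x (some (a x)), W.phase⟩ := by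
      refine ⟨fun j y hj hw => ?_, hb.check, fun y v hv => ?_⟩
      · by_cases hy : y = x
        · subst hy
          simp
        · simpa [hy] using hb.wrote j y hj hw
      · by_cases hy : y = x
        · subst hy
          simpa [eq_comm] using hv
        · exact hb.reg y v (by simpa [hy] using hv)
    refine hb'.update _ _ _ (fun y hy _ => ?_) (by simp)
    rw [hi, Option.some.injEq] at hy
    simp [hy]
  · refine hb.update _ _ _ (fun y hy _ => wrote (by simp [hp]) y hy) ?_
    unfold afterLook
    split_ifs with h1 h2
    · intro _
      exact ⟨by rw [hi, h2.1], h2.2⟩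
    · simp
    · simp
  · refine hb.update _ _ _ (fun y hy _ => wrote (by simp [hp]) y hy) ?_
    cases W.reg true <;> simp
  · exact hb.update _ _ _ (fun y hy _ => wrote (by simp [hp]) y hy) (by simp)
  · exact hb.update _ _ _ (fun y hy _ => wrote (by simp [hp]) y hy) (by simp)
  · exact hb.update _ _ _ (fun y hy _ => wrote (by simp [hp]) y hy) (by simp)
  · exact hb

/-- Away from `q₀` a process that looks goes on to `fetch`, so no member of `l` acts again and `l`
stays free of repetitions. In `q₀` only team `true` can act and so leads again: a process of team
`false` is sent to `check`, where it finds the register of team `true` filled. -/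
theorem Won.next [DecidableEq ι] (hr : Recording T side q₀ op)
    {y : Bool} {l : List ι} (h : Won T side q₀ op a y l W) (d : V)
    {i : ι} {x : Bool} (hi : side i = some x) :
    ∃ l', Won T side q₀ op a y l' (W.next (wins T side q₀ op) q₀ op d i x (a x)) := by
  have hw := h.wins_eq hr
  unfold View.next
  rcases hp : W.phase i with _ | _ | _ | _ | _ | z | v
  · have h' : Won T side q₀ op a y l ⟨W.obj, Function.update W.reg x (some (a x)), W.phase⟩ := by
      refine ⟨?_, h.obj, h.team, h.notAct, h.fetch, h.done, h.check, h.cons, h.nil⟩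
      by_cases hy : y = x
      · subst hy
        simp
      · simpa [hy] using h.reg
    exact ⟨l, h'.update _ _ (by simp) (by simp) (by simp) (by simp)⟩
  · refine ⟨l, ?_⟩
    unfold afterLook
    split_ifs with h1 h2
    · have hl : l = [] := by
        by_contra hl
        exact (h.cons hl).1 h1
      exact h.update _ _ (by simp) (by simp) (by simp) (by simp [(h.nil hl).1])
    · have hl : l = [] := by
        by_contra hl
        exact (h.cons hl).1 h1
      refine h.update _ _ (fun _ => ⟨hl, ?_⟩) (by simp) (by simp) (by simp)
      rw [hi]
      cases x
      · simp [(h.nil hl).2.1] at h2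
      · rfl
    · refine h.update _ _ (by simp) ?_ (by simp) (by simp)
      rintro z hz
      rw [Phase.fetch.injEq] at hz
      rw [← hz, hw]
  · have hy : y = true := by
      by_contra hy
      exact h.check (by simpa using hy) i hp
    subst hy
    rw [h.reg]
    exact ⟨l, h.update _ _ (by simp) (by simp) (by simp) (by simp)⟩
  · have hil : i ∉ l := fun hil => h.notAct i hil hp
    refine Won.of_act hr hp h.obj ?_ h.notAct ?_ h.reg h.fetch h.done
      (fun hy j _ => h.check hy j)
    · intro j hj
      rcases List.mem_append.1 hj with hj | hj
      · exact h.team j hj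
      · simp only [List.mem_singleton] at hj
        simp [hj, hi]
    · by_cases hl : l = []
      · subst hl
        refine Leads.singleton ?_
        obtain ⟨rfl, -, h3⟩ := h.nil rfl
        rw [hi]
        cases x
        · exact absurd hp (h3 i hi)
        · rfl
      · exact (h.cons hl).2.append_singleton hil
  · refine ⟨l, h.update _ _ (by simp) ?_ (by simp) (by simp)⟩
    intro z hz
    rw [Phase.fetch.injEq] at hz
    rw [← hz, hw]
  · refine ⟨l, h.update _ _ (by simp) (by simp) ?_ (by simp)⟩
    intro v hv
    rw [h.fetch i z hp, h.reg] at hv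
    simpa [eq_comm] using hv
  · exact ⟨l, h⟩

/-- Two events decide the contest: the first access to the object, and the discovery in phase
`check` that team `true` has announced a value. When `check` is in use, team `false` has only one
process, so no other process can be in `check` or wait in `act` for that team. -/
theorem Open.next [DecidableEq ι] (hr : Recording T side q₀ op)
    (hb : Base T side q₀ op a W) (h : Open q₀ W) (d : V)
    {i : ι} {x : Bool} (hi : side i = some x) :
    Open q₀ (W.next (wins T side q₀ op) q₀ op d i x (a x)) ∨
    ∃ y l, Won T side q₀ op a y l (W.next (wins T side q₀ op) q₀ op d i x (a x)) := by
  have hrank := h.rank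
  have fetch : ∀ (x : Bool) i y, W.phase i = .fetch y → y = x := by
    intro x i y hy
    have := hrank i
    simp [hy, Phase.rank] at this
  have done : ∀ (x : Bool) i v, W.phase i = .done v → v = a x := by
    intro x i y hy
    have := hrank i
    simp [hy, Phase.rank] at this
  have unique : wins T side q₀ op q₀ = true → ∀ j k, side j = some false → side k = some false →
      j = k := by
    intro hw
    simp only [wins, decide_eq_true_eq] at hw
    obtain ⟨l, hl, hs, he⟩ := hw
    exact hr.single l hl hs he
  unfold View.next
  rcases hp : W.phase i with _ | _ | _ | _ | _ | z | v
  · exact .inl (h.update _ _ _ (by simp [Phase.rank]))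
  · refine .inl (h.update _ _ _ ?_)
    unfold afterLook
    rw [if_pos h.obj]
    split_ifs <;> simp [Phase.rank]
  · obtain ⟨h1, h2⟩ := hb.check i hp
    rcases hR : W.reg true with _ | v
    · exact .inl (h.update _ _ _ (by simp [Phase.rank]))
    -- Team `true` is declared the winner with empty history, as no process has accessed the object.
    · obtain rfl := hb.reg true v hR
      refine .inr ⟨true, [], hR, h.obj, by simp, by simp, ?_, ?_, by simp, by simp, fun _ =>
        ⟨rfl, h2, fun j hj => ?_⟩⟩
      · intro j y
        by_cases hij : j = i
        · subst hij
          simp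
        · simpa [hij] using fetch true j y
      · intro j v
        by_cases hij : j = i
        · subst hij
          simp [eq_comm]
        · simpa [hij] using done true j v
      · simp [unique h2 j i hj h1]
  · right
    obtain ⟨l, hl⟩ := Won.of_act (x := x) (l := []) hr hp h.obj (by simp [hi]) (by simp)
      (.singleton hi) (hb.wrote i x hi (by simp [hp])) (fetch x) (done x) (by
        rintro rfl j hj hc
        obtain ⟨h1, h2⟩ := hb.check j hc
        exact hj (unique h2 j i h1 hi))
    exact ⟨x, l, hl⟩
  · have := hrank i
    simp [hp, Phase.rank] at this
  · have := hrank i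
    simp [hp, Phase.rank] at this
  · have := hrank i
    simp [hp, Phase.rank] at this

theorem Status.next [DecidableEq ι] (hr : Recording T side q₀ op)
    {s : Option Bool} (h : Status T side q₀ op a s W) (d : V)
    {i : ι} {x : Bool} (hi : side i = some x) :
    ∃ s', (s = none ∨ s' = s) ∧
      Status T side q₀ op a s' (W.next (wins T side q₀ op) q₀ op d i x (a x)) := by
  rcases s with _ | y
  · obtain ⟨hb, ho⟩ := h
    rcases ho.next hr hb d hi with ho | ⟨y, l, hw⟩
    · exact ⟨none, .inl rfl, hb.next d hi, ho⟩
    · exact ⟨some y, .inl rfl, hb.next d hi, l, hw⟩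
  · obtain ⟨hb, l, hw⟩ := h
    exact ⟨some y, .inr rfl, hb.next d hi, hw.next hr d hi⟩

theorem Status.crash [DecidableEq ι] {s : Option Bool} (h : Status T side q₀ op a s W) (i : ι) :
    Status T side q₀ op a s ⟨W.obj, W.reg, Function.update W.phase i .write⟩ := by
  have hb := h.base.update W.obj i .write (by simp) (by simp)
  rcases s with _ | y
  · exact ⟨hb, h.2.update _ _ _ (by simp [Phase.rank])⟩
  · obtain ⟨-, l, hw⟩ := h
    exact ⟨hb, l, hw.update _ _ (by simp) (by simp) (by simp) (by simp)⟩

theorem Status.done {s : Option Bool} (h : Status T side q₀ op a s W) {i : ι} {v : V}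
    (hi : W.phase i = .done v) : ∃ x, s = some x ∧ v = a x := by
  rcases s with _ | x
  · have := h.2.rank i
    simp [hi, Phase.rank] at this
  · obtain ⟨-, l, hw⟩ := h
    exact ⟨x, rfl, hw.done i v hi⟩

theorem status_init : Status T side q₀ op a none ⟨q₀, fun _ => none, fun _ => .write⟩ :=
  ⟨⟨by simp, by simp, by simp⟩, rfl, by simp [Phase.rank]⟩

theorem rank_next [DecidableEq ι] (w : T.State → Bool) (d : V) (i : ι) (x : Bool) (v : V) :
    ((W.next w q₀ op d i x v).phase i).rank ≤ (W.phase i).rank - 1 := by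
  unfold View.next
  rcases hp : W.phase i with _ | _ | _ | _ | _ | z | v
  · simp [Phase.rank]
  · simp only [Function.update_self, afterLook]
    split_ifs <;> simp [Phase.rank]
  · cases W.reg true <;> simp [Phase.rank]
  · simp [Phase.rank]
  · simp [Phase.rank]
  · simp [Phase.rank]
  · simp [Phase.rank, hp]

end

end View

end RecoverableConsensus

/-! ### Combining the algorithms of two teams -/

namespace RecoverableConsensus

/-- What the processes of two teams need to agree on a value, given an algorithm for each team. -/
structure Tournament (T : DetType.{u}) (V : Type u) (n : ℕ) where
  sub : Bool → Algorithm T V n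
  side : Fin n → Option Bool
  init : T.State
  op : Fin n → T.Op
  read : T.Op
  decode : T.Resp → T.State
  regVal : ∀ x, (sub x).RegVal
  default : V

namespace Tournament

variable {T : DetType.{u}} {V : Type u} {n : ℕ} (M : Tournament T V n)

/-- Names of objects: those of the teams, and one by which the teams decide who wins. -/
abbrev Obj : Type u := (Σ x, (M.sub x).Obj) ⊕ PUnit.{u + 1}

/-- Names of registers: those of the teams, and for each team one that holds its value. -/
abbrev Reg : Type u := (Σ x, (M.sub x).Reg) ⊕ ULift.{u} Bool

abbrev RegVal : Type u := (∀ x, (M.sub x).RegVal) × Option V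

abbrev Loc : Type u := (∀ x, (M.sub x).Loc) × Phase V

/-- The next step of process `i` of team `x`, after its team agreed on `v`. -/
noncomputable def protocol (i : Fin n) (x : Bool) (v : V) (l : ∀ x, (M.sub x).Loc) :
    Phase V → Action T V M.Obj M.Reg M.RegVal M.Loc
  | .write => .writeReg (.inr ⟨x⟩) (M.regVal, some v) (l, .look)
  | .look => .invoke (.inr ⟨⟩) M.read
      fun r => (l, afterLook (wins T M.side M.init M.op) M.init x (M.decode r))
  | .check => .readReg (.inr ⟨true⟩) fun w => (l, w.2.elim .act .done)
  | .act => .invoke (.inr ⟨⟩) (M.op i) fun _ => (l, .relook)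
  | .relook => .invoke (.inr ⟨⟩) M.read
      fun r => (l, .fetch (wins T M.side M.init M.op (M.decode r)))
  | .fetch y => .readReg (.inr ⟨y⟩) fun w => (l, .done (w.2.getD M.default))
  | .done v => .output v

/-- The next step of process `i` of team `x`: it follows the algorithm of its team until this outputs a
value, and then the protocol between the teams. -/
noncomputable def member (i : Fin n) (x : Bool) (l : M.Loc) :
    Action T V M.Obj M.Reg M.RegVal M.Loc :=
  match (M.sub x).code i (l.1 x) with
  | .invoke o op cont => .invoke (.inl ⟨x, o⟩) op fun r => (Function.update l.1 x (cont r), l.2)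
  | .readReg r cont => .readReg (.inl ⟨x, r⟩) fun w => (Function.update l.1 x (cont (w.1 x)), l.2)
  | .writeReg r w cont => .writeReg (.inl ⟨x, r⟩) (Function.update M.regVal x w, none)
      (Function.update l.1 x cont, l.2)
  | .output v => M.protocol i x v l.1 l.2

/-- The algorithm by which two teams agree. -/
noncomputable abbrev alg : Algorithm T V n where
  Obj := M.Obj
  Reg := M.Reg
  RegVal := M.RegVal
  Loc := M.Loc
  initObj := Sum.elim (fun o => (M.sub o.1).initObj o.2) fun _ => M.init
  initReg := Sum.elim (fun r => (Function.update M.regVal r.1 ((M.sub r.1).initReg r.2), none))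
    fun _ => (M.regVal, none)
  start i v := (fun x => (M.sub x).start i v, .write)
  code i l := (M.side i).elim (.output M.default) fun x => M.member i x l

/-- The part of a configuration that concerns the algorithm of team `x`. -/
def proj (x : Bool) (C : M.alg.Config) : (M.sub x).Config where
  obj o := C.obj (.inl ⟨x, o⟩)
  reg r := (C.reg (.inl ⟨x, r⟩)).1 x
  loc i := (C.loc i).1 x

/-- The part of a configuration that concerns the protocol between the teams. -/
def view (C : M.alg.Config) : View T.State V (Fin n) where
  obj := C.obj (.inr ⟨⟩)
  reg y := (C.reg (.inr ⟨y⟩)).2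
  phase i := (C.loc i).2

theorem code_of_none {i : Fin n} (hi : M.side i = none) (l : M.Loc) :
    M.alg.code i l = .output M.default := by
  simp [alg, hi]

theorem code_of_some {i : Fin n} {x : Bool} (hi : M.side i = some x) (l : M.Loc) :
    M.alg.code i l = M.member i x l := by
  simp [alg, hi]

theorem code_invoke {i : Fin n} {x : Bool} (hi : M.side i = some x) {l : M.Loc} {o op cont}
    (h : (M.sub x).code i (l.1 x) = .invoke o op cont) :
    M.alg.code i l = .invoke (.inl ⟨x, o⟩) op fun r => (Function.update l.1 x (cont r), l.2) := by
  rw [M.code_of_some hi, member, h]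

theorem code_readReg {i : Fin n} {x : Bool} (hi : M.side i = some x) {l : M.Loc} {r cont}
    (h : (M.sub x).code i (l.1 x) = .readReg r cont) :
    M.alg.code i l =
      .readReg (.inl ⟨x, r⟩) fun w => (Function.update l.1 x (cont (w.1 x)), l.2) := by
  rw [M.code_of_some hi, member, h]

theorem code_writeReg {i : Fin n} {x : Bool} (hi : M.side i = some x) {l : M.Loc} {r w cont}
    (h : (M.sub x).code i (l.1 x) = .writeReg r w cont) :
    M.alg.code i l = .writeReg (.inl ⟨x, r⟩) (Function.update M.regVal x w, none)
      (Function.update l.1 x cont, l.2) := by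
  rw [M.code_of_some hi, member, h]

theorem code_output {i : Fin n} {x : Bool} (hi : M.side i = some x) {l : M.Loc} {v}
    (h : (M.sub x).code i (l.1 x) = .output v) :
    M.alg.code i l = M.protocol i x v l.1 l.2 := by
  rw [M.code_of_some hi, member, h]

section Step

variable (inp : Fin n → V) {C : M.alg.Config} {i : Fin n} {x : Bool}

theorem view_update_loc (obj : M.Obj → T.State) (reg : M.Reg → M.RegVal) (loc : Fin n → M.Loc)
    (i : Fin n) (l : ∀ x, (M.sub x).Loc) (p : Phase V) :
    M.view ⟨obj, reg, Function.update loc i (l, p)⟩ =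
      ⟨obj (.inr ⟨⟩), fun y => (reg (.inr ⟨y⟩)).2, Function.update (fun j => (loc j).2) i p⟩ := by
  ext1
  · rfl
  · rfl
  · funext j
    by_cases hij : j = i
    · subst hij
      simp [view]
    · simp [view, hij]

theorem proj_update_loc (y : Bool) (obj : M.Obj → T.State) (reg : M.Reg → M.RegVal)
    (loc : Fin n → M.Loc) (i : Fin n) (l : ∀ x, (M.sub x).Loc) (p : Phase V) :
    M.proj y ⟨obj, reg, Function.update loc i (l, p)⟩ =
      ⟨fun o => obj (.inl ⟨y, o⟩), fun r => (reg (.inl ⟨y, r⟩)).1 y,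
        Function.update (fun j => (loc j).1 y) i (l y)⟩ := by
  simp only [proj, Algorithm.Config.mk.injEq, true_and]
  funext j
  by_cases hij : j = i
  · subst hij
    simp
  · simp [hij]

theorem update_loc_self (y : Bool) (loc : Fin n → M.Loc) (i : Fin n) :
    Function.update (fun j => (loc j).1 y) i ((loc i).1 y) = fun j => (loc j).1 y :=
  Function.update_eq_self i (fun j => (loc j).1 y)

/-- A step in the protocol between the teams. -/
theorem next_of_sub_output (hread : ∀ q, (T.apply q M.read).1 = q ∧ M.decode (T.apply q M.read).2 = q)
    (hi : M.side i = some x) {v : V} (h : (M.sub x).code i ((C.loc i).1 x) = .output v) :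
    M.view (M.alg.next inp C (.step i)) =
        (M.view C).next (wins T M.side M.init M.op) M.init M.op M.default i x v ∧
      ∀ y, M.proj y (M.alg.next inp C (.step i)) = M.proj y C := by
  have hc := M.code_output hi h
  unfold View.next
  have hv : (M.view C).phase i = (C.loc i).2 := rfl
  rcases hp : (C.loc i).2 with _ | _ | _ | _ | _ | z | v <;> rw [hp] at hc <;> rw [hv, hp]
  · rw [M.alg.next_of_writeReg inp hc]
    refine ⟨?_, fun y => ?_⟩
    · rw [view_update_loc]
      ext1
      · rfl
      · funext y
        by_cases hy : y = x
        · subst hy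
          simp
        · have : (Sum.inr ⟨y⟩ : M.Reg) ≠ Sum.inr ⟨x⟩ := by simpa using hy
          simp [hy, this, view]
      · rfl
    · rw [proj_update_loc, update_loc_self]
      simp [proj]
  · rw [M.alg.next_of_invoke inp hc, view_update_loc]
    refine ⟨?_, fun y => ?_⟩
    · simp only [Function.update_self, (hread _).1, (hread _).2]
      rfl
    · rw [proj_update_loc, update_loc_self]
      simp [proj]
  · rw [M.alg.next_of_readReg inp hc, view_update_loc]
    refine ⟨rfl, fun y => ?_⟩
    rw [proj_update_loc, update_loc_self]
    rfl
  · rw [M.alg.next_of_invoke inp hc, view_update_loc]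
    refine ⟨?_, fun y => ?_⟩
    · simp only [Function.update_self]
      rfl
    · rw [proj_update_loc, update_loc_self]
      simp [proj]
  · rw [M.alg.next_of_invoke inp hc, view_update_loc]
    refine ⟨?_, fun y => ?_⟩
    · simp only [Function.update_self, (hread _).1, (hread _).2]
      rfl
    · rw [proj_update_loc, update_loc_self]
      simp [proj]
  · rw [M.alg.next_of_readReg inp hc, view_update_loc]
    refine ⟨rfl, fun y => ?_⟩
    rw [proj_update_loc, update_loc_self]
    rfl
  · rw [M.alg.next_of_output inp hc]
    exact ⟨rfl, fun y => rfl⟩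

theorem update_loc_of_ne {y : Bool} (hy : y ≠ x) (loc : Fin n → M.Loc) (i : Fin n)
    (l : (M.sub x).Loc) :
    Function.update (fun j => (loc j).1 y) i (Function.update (loc i).1 x l y) =
      fun j => (loc j).1 y := by
  rw [Function.update_of_ne hy, update_loc_self]

/-- A step in the algorithm of a team. -/
theorem next_of_sub_ne_output (hi : M.side i = some x)
    (h : ∀ v, (M.sub x).code i ((C.loc i).1 x) ≠ .output v) :
    M.view (M.alg.next inp C (.step i)) = M.view C ∧
      M.proj x (M.alg.next inp C (.step i)) = (M.sub x).next inp (M.proj x C) (.step i) ∧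
      ∀ y, y ≠ x → M.proj y (M.alg.next inp C (.step i)) = M.proj y C := by
  have hph : Function.update (fun j => (C.loc j).2) i (C.loc i).2 = fun j => (C.loc j).2 :=
    Function.update_eq_self i (fun j => (C.loc j).2)
  rcases hc : (M.sub x).code i ((C.loc i).1 x) with ⟨o, op, cont⟩ | ⟨r, cont⟩ | ⟨r, w, cont⟩ | v
  · have hc' : (M.sub x).code i ((M.proj x C).loc i) = _ := hc
    rw [M.alg.next_of_invoke inp (M.code_invoke hi hc), (M.sub x).next_of_invoke inp hc',
      view_update_loc, hph]
    refine ⟨?_, ?_, fun y hy => ?_⟩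
    · simp [view]
    · rw [proj_update_loc, Function.update_self]
      simp only [proj, Algorithm.Config.mk.injEq, and_true]
      funext s
      by_cases hs : s = o
      · subst hs
        simp
      · have : (Sum.inl ⟨x, s⟩ : M.Obj) ≠ Sum.inl ⟨x, o⟩ := by simpa using hs
        simp [hs, this]
    · rw [proj_update_loc, update_loc_of_ne _ hy]
      simp [proj, hy]
  · have hc' : (M.sub x).code i ((M.proj x C).loc i) = _ := hc
    rw [M.alg.next_of_readReg inp (M.code_readReg hi hc), (M.sub x).next_of_readReg inp hc',
      view_update_loc, hph]
    refine ⟨rfl, ?_, fun y hy => ?_⟩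
    · rw [proj_update_loc, Function.update_self]
      rfl
    · rw [proj_update_loc, update_loc_of_ne _ hy]
      rfl
  · have hc' : (M.sub x).code i ((M.proj x C).loc i) = _ := hc
    rw [M.alg.next_of_writeReg inp (M.code_writeReg hi hc), (M.sub x).next_of_writeReg inp hc',
      view_update_loc, hph]
    refine ⟨?_, ?_, fun y hy => ?_⟩
    · simp [view]
    · rw [proj_update_loc, Function.update_self]
      simp only [proj, Algorithm.Config.mk.injEq, and_true, true_and]
      funext s
      by_cases hs : s = r
      · subst hs
        simp
      · have : (Sum.inl ⟨x, s⟩ : M.Reg) ≠ Sum.inl ⟨x, r⟩ := by simpa using hs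
        simp [hs, this]
    · rw [proj_update_loc, update_loc_of_ne _ hy]
      simp [proj, hy]
  · exact absurd hc (h v)

theorem view_crash (C : M.alg.Config) (i : Fin n) :
    M.view (M.alg.next inp C (.crash i)) = ⟨(M.view C).obj, (M.view C).reg,
      Function.update (M.view C).phase i .write⟩ := by
  rw [Algorithm.next_crash, view_update_loc]
  rfl

theorem proj_crash (C : M.alg.Config) (i : Fin n) (y : Bool) :
    M.proj y (M.alg.next inp C (.crash i)) = (M.sub y).next inp (M.proj y C) (.crash i) := by
  rw [Algorithm.next_crash, proj_update_loc]
  rfl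

theorem next_of_none (hi : M.side i = none) : M.alg.next inp C (.step i) = C :=
  M.alg.next_of_output inp (M.code_of_none hi _)

end Step

/-- The algorithm of a team runs as it does without the other team. -/
theorem proj_next (hread : ∀ q, (T.apply q M.read).1 = q ∧ M.decode (T.apply q M.read).2 = q)
    (hidle : ∀ y i, M.side i ≠ some y → ∀ l, ∃ v, (M.sub y).code i l = .output v)
    (inp : Fin n → V) (C : M.alg.Config) (e : Event n) (y : Bool) :
    M.proj y (M.alg.next inp C e) = (M.sub y).next inp (M.proj y C) e := by
  rcases e with i | i
  · have idle : M.side i ≠ some y → (M.sub y).next inp (M.proj y C) (.step i) = M.proj y C := by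
      intro h
      obtain ⟨v, hv⟩ := hidle y i h ((M.proj y C).loc i)
      exact (M.sub y).next_of_output inp hv
    rcases hi : M.side i with _ | x
    · rw [M.next_of_none inp hi, idle (by simp [hi])]
    · by_cases ho : ∃ v, (M.sub x).code i ((C.loc i).1 x) = .output v
      · obtain ⟨v, hv⟩ := ho
        rw [(M.next_of_sub_output inp hread hi hv).2]
        by_cases hy : y = x
        · subst hy
          exact ((M.sub y).next_of_output inp (C := M.proj y C) hv).symm
        · rw [idle (by simp [hi, Ne.symm hy])]
      · push Not at ho
        obtain ⟨-, h1, h2⟩ := M.next_of_sub_ne_output inp hi ho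
        by_cases hy : y = x
        · subst hy
          exact h1
        · rw [h2 y hy, idle (by simp [hi, Ne.symm hy])]
  · exact M.proj_crash inp C i y

theorem proj_init (inp : Fin n → V) (y : Bool) :
    M.proj y (M.alg.init inp) = (M.sub y).init inp := by
  simp [proj, Algorithm.init]

theorem proj_run (hread : ∀ q, (T.apply q M.read).1 = q ∧ M.decode (T.apply q M.read).2 = q)
    (hidle : ∀ y i, M.side i ≠ some y → ∀ l, ∃ v, (M.sub y).code i l = .output v)
    (inp : Fin n → V) (es : List (Event n)) (y : Bool) :
    M.proj y (M.alg.run inp es) = (M.sub y).run inp es := by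
  induction es using List.reverseRecOn with
  | nil => exact M.proj_init inp y
  | append_singleton es e ih =>
    rw [Algorithm.run_append_singleton, Algorithm.run_append_singleton,
      M.proj_next hread hidle, ih]

theorem outputs_iff {C : M.alg.Config} {i : Fin n} {x : Bool} (hi : M.side i = some x) (v : V) :
    M.alg.code i (C.loc i) = .output v ↔
      (∃ w, (M.sub x).code i ((C.loc i).1 x) = .output w) ∧ (C.loc i).2 = .done v := by
  rcases hc : (M.sub x).code i ((C.loc i).1 x) with ⟨o, op, cont⟩ | ⟨r, cont⟩ | ⟨r, w, cont⟩ | w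
  · rw [M.code_invoke hi hc]
    simp
  · rw [M.code_readReg hi hc]
    simp
  · rw [M.code_writeReg hi hc]
    simp
  · rw [M.code_output hi hc]
    cases (C.loc i).2 <;> simp [protocol]

theorem status_next (hread : ∀ q, (T.apply q M.read).1 = q ∧ M.decode (T.apply q M.read).2 = q)
    (hr : Recording T M.side M.init M.op) {a : Bool → V} {s : Option Bool} (inp : Fin n → V)
    {C : M.alg.Config} (h : View.Status T M.side M.init M.op a s (M.view C))
    (ha : ∀ i x v, M.side i = some x → (M.sub x).code i ((C.loc i).1 x) = .output v → v = a x)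
    (e : Event n) :
    ∃ s', (s = none ∨ s' = s) ∧
      View.Status T M.side M.init M.op a s' (M.view (M.alg.next inp C e)) := by
  rcases e with i | i
  · rcases hi : M.side i with _ | x
    · rw [M.next_of_none inp hi]
      exact ⟨s, .inr rfl, h⟩
    · by_cases ho : ∃ v, (M.sub x).code i ((C.loc i).1 x) = .output v
      · obtain ⟨v, hv⟩ := ho
        rw [(M.next_of_sub_output inp hread hi hv).1, ha i x v hi hv]
        exact h.next hr _ hi
      · push Not at ho
        rw [(M.next_of_sub_ne_output inp hi ho).1]
        exact ⟨s, .inr rfl, h⟩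
  · rw [M.view_crash]
    exact ⟨s, .inr rfl, h.crash i⟩

/-- The winner never changes once it is determined, so the winner at the end of `es` accounts for
every output at any prefix. -/
theorem exists_status (hread : ∀ q, (T.apply q M.read).1 = q ∧ M.decode (T.apply q M.read).2 = q)
    (hidle : ∀ y i, M.side i ≠ some y → ∀ l, ∃ v, (M.sub y).code i l = .output v)
    (hr : Recording T M.side M.init M.op) {a : Bool → V} (inp : Fin n → V) (es : List (Event n))
    (ha : ∀ fs, fs <+: es → ∀ i x v, M.side i = some x → (M.sub x).Outputs inp fs i v → v = a x) :
    ∃ s, View.Status T M.side M.init M.op a s (M.view (M.alg.run inp es)) ∧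
      ∀ fs, fs <+: es → ∃ s', (s' = none ∨ s' = s) ∧
        View.Status T M.side M.init M.op a s' (M.view (M.alg.run inp fs)) := by
  induction es using List.reverseRecOn with
  | nil =>
    have h : View.Status T M.side M.init M.op a none (M.view (M.alg.run inp [])) :=
      View.status_init
    refine ⟨none, h, fun fs hfs => ?_⟩
    rw [List.prefix_nil.1 hfs]
    exact ⟨none, .inl rfl, h⟩
  | append_singleton es e ih =>
    obtain ⟨s, hs, hs'⟩ := ih fun fs hfs => ha fs (hfs.trans (List.prefix_append _ _))
    obtain ⟨s₁, h1, h2⟩ := M.status_next hread hr inp hs (fun i x v hi hv =>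
      ha es (List.prefix_append _ _) i x v hi (by
        rw [Algorithm.Outputs, ← M.proj_run hread hidle]
        exact hv)) e
    rw [← Algorithm.run_append_singleton] at h2
    refine ⟨s₁, h2, fun fs hfs => ?_⟩
    rcases List.prefix_concat_iff.1 hfs with rfl | hfs
    · exact ⟨s₁, .inr rfl, h2⟩
    · obtain ⟨s', h3, h4⟩ := hs' fs hfs
      refine ⟨s', ?_, h4⟩
      rcases h3 with rfl | rfl
      · exact .inl rfl
      · rcases h1 with rfl | rfl
        · exact .inl rfl
        · exact .inr rfl

/-- Once the team's algorithm has an output for `i`, only steps of `i` change its local state, and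
each of them lowers the rank of the phase unless it is already `0`. -/
theorem exists_outputs (hread : ∀ q, (T.apply q M.read).1 = q ∧ M.decode (T.apply q M.read).2 = q)
    {inp : Fin n → V} {e : ℕ → Event n} {i : Fin n} {x : Bool} (hi : M.side i = some x) {t₁ : ℕ}
    (hc : ∀ t, t₁ ≤ t → e t ≠ .crash i) (hs : ∀ s, ∃ t, s ≤ t ∧ e t = .step i) {v : V}
    (hv : (M.sub x).code i (((M.alg.run inp (List.ofFn fun k : Fin t₁ => e k)).loc i).1 x) =
      .output v) :
    ∃ t w, t₁ ≤ t ∧ M.alg.Outputs inp (List.ofFn fun k : Fin t => e k) i w := by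
  set R : ℕ → M.alg.Config := fun t => M.alg.run inp (List.ofFn fun k : Fin t => e k) with hR
  have succ : ∀ t, R (t + 1) = M.alg.next inp (R t) (e t) := M.alg.run_ofFn_succ inp e
  have key : ∀ t, t₁ ≤ t → (M.sub x).code i (((R t).loc i).1 x) = .output v →
      (M.sub x).code i (((R (t + 1)).loc i).1 x) = .output v ∧
      ((R (t + 1)).loc i).2.rank ≤ ((R t).loc i).2.rank ∧
      (e t = .step i → ((R (t + 1)).loc i).2.rank ≤ ((R t).loc i).2.rank - 1) := by
    intro t ht ho
    rw [succ]
    by_cases he : e t = .step i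
    · rw [he]
      obtain ⟨h1, h2⟩ := M.next_of_sub_output inp hread hi ho
      have h3 : ((M.alg.next inp (R t) (.step i)).loc i).1 x = ((R t).loc i).1 x :=
        congrFun (congrArg Algorithm.Config.loc (h2 x)) i
      have h4 : ((M.alg.next inp (R t) (.step i)).loc i).2.rank ≤ ((R t).loc i).2.rank - 1 := by
        have h5 := View.rank_next (q₀ := M.init) (op := M.op) (W := M.view (R t))
          (wins T M.side M.init M.op) M.default i x v
        rw [← h1] at h5
        exact h5
      rw [h3]
      exact ⟨ho, by omega, fun _ => h4⟩
    · rw [M.alg.next_loc_of_ne inp he (hc t ht)]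
      exact ⟨ho, le_rfl, fun h => absurd h he⟩
  have out : ∀ t, t₁ ≤ t → (M.sub x).code i (((R t).loc i).1 x) = .output v := by
    intro t ht
    induction t, ht using Nat.le_induction with
    | base => exact hv
    | succ t ht ih => exact (key t ht ih).1
  have mono : ∀ t, t₁ ≤ t → ∀ s, t ≤ s → ((R s).loc i).2.rank ≤ ((R t).loc i).2.rank := by
    intro t ht s hts
    induction s, hts using Nat.le_induction with
    | base => exact le_rfl
    | succ s hts ih => exact (key s (ht.trans hts) (out s (ht.trans hts))).2.1.trans ih
  have reach : ∀ r t, t₁ ≤ t → ((R t).loc i).2.rank ≤ r →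
      ∃ s, t₁ ≤ s ∧ ((R s).loc i).2.rank = 0 := by
    intro r
    induction r with
    | zero => exact fun t ht h => ⟨t, ht, Nat.le_zero.1 h⟩
    | succ r ih =>
      intro t ht h
      obtain ⟨s, hs1, hs2⟩ := hs t
      have h1 := (key s (ht.trans hs1) (out s (ht.trans hs1))).2.2 hs2
      have h2 := mono t ht s hs1
      exact ih (s + 1) (by omega) (by omega)
  obtain ⟨t, ht, h0⟩ := reach _ t₁ le_rfl le_rfl
  rcases hp : ((R t).loc i).2 with _ | _ | _ | _ | _ | z | w
  all_goals try (rw [hp] at h0; simp [Phase.rank] at h0; done)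
  exact ⟨t, w, ht, (M.outputs_iff hi w).2 ⟨⟨v, out t ht⟩, hp⟩⟩

theorem solvesOn (hread : ∀ q, (T.apply q M.read).1 = q ∧ M.decode (T.apply q M.read).2 = q)
    (hr : Recording T M.side M.init M.op)
    (hsub : ∀ x, (M.sub x).SolvesOn {i | M.side i = some x}) :
    M.alg.SolvesOn {i | M.side i ≠ none} := by
  have hidle : ∀ y i, M.side i ≠ some y → ∀ l, ∃ v, (M.sub y).code i l = .output v :=
    fun y i hi => (hsub y).idle i hi
  refine ⟨?_, ⟨(M.regVal, none)⟩, ?_, ?_⟩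
  · intro i hi l
    exact ⟨_, M.code_of_none (by simpa using hi) l⟩
  · intro inp es
    choose j hj hj' using fun x => (hsub x).agree inp es
    obtain ⟨s, -, hs⟩ := M.exists_status hread hidle hr (a := fun x => inp (j x)) inp es
      (fun fs hfs i x v hi hv => hj' x fs hfs i hi v hv)
    have mem : ∀ x, j x ∈ {i | M.side i ≠ none} := by
      intro x
      have : M.side (j x) = some x := hj x
      simp [this]
    -- If no team has won there are no outputs, and the default `true` is arbitrary.
    refine ⟨j (s.getD true), mem _, ?_⟩
    intro fs hfs i hi v hv
    obtain ⟨x, hx⟩ := Option.ne_none_iff_exists'.1 hi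
    obtain ⟨s', h1, h2⟩ := hs fs hfs
    obtain ⟨y, rfl, hy⟩ := h2.done ((M.outputs_iff hx v).1 hv).2
    rcases h1 with h1 | rfl
    · simp at h1
    · exact hy
  · intro inp e i hi t₀ hc hs
    obtain ⟨x, hx⟩ := Option.ne_none_iff_exists'.1 hi
    obtain ⟨t₁, v, ht, hv⟩ := (hsub x).waitFree inp e i hx t₀ hc hs
    rw [Algorithm.Outputs, ← M.proj_run hread hidle] at hv
    obtain ⟨t, w, h1, h2⟩ := M.exists_outputs hread hx (fun t h => hc t (ht.trans h)) hs hv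
    exact ⟨t, w, ht.trans h1, h2⟩

end Tournament

/-- A readable type with the recording property for all numbers of processes up to `n` solves
recoverable consensus among the processes of any nonempty set. -/
theorem exists_solvesOn {V : Type u} [Nonempty V] {T : DetType.{u}} (hT : T.Readable) {n : ℕ}
    (hrec : ∀ P : Finset (Fin n), 2 ≤ P.card →
      ∃ (side : Fin n → Option Bool) (q₀ : T.State) (op : Fin n → T.Op),
        (∀ i, side i ≠ none ↔ i ∈ P) ∧ (∀ x, ∃ i, side i = some x) ∧ Recording T side q₀ op)
    (P : Finset (Fin n)) (hP : P.Nonempty) :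
    ∃ A : Algorithm T V n, A.SolvesOn (P : Set (Fin n)) := by
  classical
  induction P using Finset.strongInduction with
  | H P ih =>
  by_cases h1 : 2 ≤ P.card
  · obtain ⟨side, q₀, op, hside, hne, hr⟩ := hrec P h1
    obtain ⟨read, report, hinj, hread⟩ := hT
    have : Nonempty T.State := ⟨q₀⟩
    have hsub : ∀ x, ∃ A : Algorithm T V n, A.SolvesOn {i | side i = some x} := by
      intro x
      -- Each team is a proper subset of `P` because the other one is nonempty.
      obtain ⟨A, hA⟩ := ih {i ∈ P | side i = some x} (by
        obtain ⟨i, hi⟩ := hne !x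
        refine Finset.filter_ssubset.2 ⟨i, (hside i).1 (by simp [hi]), ?_⟩
        simp [hi]) (by
        obtain ⟨i, hi⟩ := hne x
        exact ⟨i, Finset.mem_filter.2 ⟨(hside i).1 (by simp [hi]), hi⟩⟩)
      refine ⟨A, ?_⟩
      convert hA using 1
      ext i
      simp only [Set.mem_ofPred_eq, Finset.coe_filter]
      exact ⟨fun h => ⟨(hside i).1 (by simp [h]), h⟩, fun h => h.2⟩
    choose A hA using hsub
    let M : Tournament T V n :=
      { sub := A, side := side, init := q₀, op := op, read := read,
        decode := Function.invFun report, regVal := fun x => (hA x).regVal.some,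
        default := Classical.arbitrary V }
    refine ⟨M.alg, ?_⟩
    convert M.solvesOn ?_ hr hA using 1
    · ext i
      exact (hside i).symm
    · intro q
      simp only [M, hread]
      exact ⟨trivial, Function.leftInverse_invFun hinj q⟩
  · have := hP.card_pos
    obtain ⟨i, rfl⟩ := Finset.card_eq_one.1 (by omega : P.card = 1)
    exact ⟨Algorithm.trivial T V n, by simpa using Algorithm.trivial_solvesOn i⟩

end RecoverableConsensus

/-! ### The valency argument -/

namespace RecoverableConsensus

namespace Algorithm

variable {T : DetType.{u}} {V : Type u} {n : ℕ} (A : Algorithm T V n)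

/-- Process `p` cannot tell the two configurations apart if it is the only one to take steps. -/
structure Agree (p : Fin n) (C D : A.Config) : Prop where
  obj : C.obj = D.obj
  reg : C.reg = D.reg
  loc : C.loc p = D.loc p

variable {A}

/-- A step does not consult the inputs, so the two sides may have different ones; this is what lets
`Solves.canDecide_input` change the inputs of the other processes. -/
theorem Agree.step {p : Fin n} {C D : A.Config} (h : A.Agree p C D) (inp inp' : Fin n → V) :
    A.Agree p (A.next inp C (.step p)) (A.next inp' D (.step p)) := by
  obtain ⟨h1, h2, h3⟩ := h
  rcases hc : A.code p (C.loc p) with ⟨o, op, cont⟩ | ⟨r, cont⟩ | ⟨r, x, cont⟩ | v <;>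
    have hd := hc <;> rw [h3] at hd
  · rw [A.next_of_invoke inp hc, A.next_of_invoke inp' hd]
    exact ⟨by simp [h1], h2, by simp [h1]⟩
  · rw [A.next_of_readReg inp hc, A.next_of_readReg inp' hd]
    exact ⟨h1, h2, by simp [h2]⟩
  · rw [A.next_of_writeReg inp hc, A.next_of_writeReg inp' hd]
    exact ⟨h1, by simp [h2], by simp⟩
  · rw [A.next_of_output inp hc, A.next_of_output inp' hd]
    exact ⟨h1, h2, h3⟩

variable (A)

/-- The configuration after the processes take steps according to a schedule. -/
noncomputable def steps (inp : Fin n → V) (C : A.Config) (l : List (Fin n)) : A.Config :=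
  l.foldl (fun C i => A.next inp C (.step i)) C

@[simp] theorem steps_nil (inp : Fin n → V) (C : A.Config) : A.steps inp C [] = C := rfl

@[simp] theorem steps_cons (inp : Fin n → V) (C : A.Config) (i : Fin n) (l : List (Fin n)) :
    A.steps inp C (i :: l) = A.steps inp (A.next inp C (.step i)) l := rfl

theorem steps_append (inp : Fin n → V) (C : A.Config) (l l' : List (Fin n)) :
    A.steps inp C (l ++ l') = A.steps inp (A.steps inp C l) l' := by
  simp [steps]

theorem run_map_step (inp : Fin n → V) (l : List (Fin n)) :
    A.run inp (l.map .step) = A.steps inp (A.init inp) l := by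
  simp [run, steps, List.foldl_map]

theorem steps_loc {inp : Fin n → V} {C : A.Config} {l : List (Fin n)} {p : Fin n} (hp : p ∉ l) :
    (A.steps inp C l).loc p = C.loc p := by
  induction l generalizing C with
  | nil => rfl
  | cons i l ih =>
    simp only [List.mem_cons, not_or] at hp
    rw [steps_cons, ih hp.2]
    exact A.next_loc_of_ne inp (by simpa [eq_comm] using hp.1) (by simp)

variable {A}

theorem Agree.replicate {p : Fin n} {C D : A.Config} (h : A.Agree p C D) (inp inp' : Fin n → V)
    (m : ℕ) : A.Agree p (A.steps inp C (.replicate m p)) (A.steps inp' D (.replicate m p)) := by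
  induction m generalizing C D with
  | zero => exact h
  | succ m ih => exact ih (h.step inp inp')

variable (A)

/-- After the schedule `l`, process `p` has output `v`. -/
def Decides (inp : Fin n → V) (l : List (Fin n)) (p : Fin n) (v : V) : Prop :=
  A.code p ((A.steps inp (A.init inp) l).loc p) = .output v

/-- Some extension of the schedule `l` leads to the output `v`. -/
def CanDecide (inp : Fin n → V) (l : List (Fin n)) (v : V) : Prop :=
  ∃ l' p, A.Decides inp (l ++ l') p v

def Bivalent (inp : Fin n → V) (l : List (Fin n)) : Prop :=
  ∃ v w, v ≠ w ∧ A.CanDecide inp l v ∧ A.CanDecide inp l w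

theorem outputs_map_step (inp : Fin n → V) (l : List (Fin n)) (p : Fin n) (v : V) :
    A.Outputs inp (l.map .step) p v ↔ A.Decides inp l p v := by
  rw [Outputs, run_map_step, Decides]

variable {A}

theorem CanDecide.of_append {inp : Fin n → V} {l l' : List (Fin n)} {v : V}
    (h : A.CanDecide inp (l ++ l') v) : A.CanDecide inp l v := by
  obtain ⟨l'', p, h⟩ := h
  exact ⟨l' ++ l'', p, by rwa [← List.append_assoc]⟩

section Valency

variable {inp : Fin n → V}

theorem Solves.decides_eq (hA : A.Solves {e | ∃ i, e = .step i}) {l l' : List (Fin n)}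
    {p q : Fin n} {v w : V} (hv : A.Decides inp l p v) (hw : A.Decides inp (l ++ l') q w) :
    v = w := by
  rw [← outputs_map_step] at hv hw
  rw [List.map_append] at hw
  refine hA.agreement inp _ _ ?_ p q v w hv hw
  intro e he
  rw [← List.map_append] at he
  obtain ⟨i, -, rfl⟩ := List.mem_map.1 he
  exact ⟨i, rfl⟩

theorem Solves.not_bivalent (hA : A.Solves {e | ∃ i, e = .step i}) {l : List (Fin n)} {p : Fin n}
    {v : V} (hv : A.Decides inp l p v) : ¬ A.Bivalent inp l := by
  rintro ⟨u, w, huw, ⟨l₁, p₁, h₁⟩, l₂, p₂, h₂⟩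
  exact huw ((hA.decides_eq hv h₁).symm.trans (hA.decides_eq hv h₂))

/-- Any process that runs alone decides. -/
theorem Solves.exists_solo (hA : A.Solves {e | ∃ i, e = .step i}) (l : List (Fin n)) (p : Fin n) :
    ∃ m v, A.Decides inp (l ++ .replicate m p) p v := by
  -- The default value of `getD` makes `p` run alone forever once `l` is exhausted.
  obtain ⟨t, v, ht, hv⟩ := hA.waitFree inp (fun t => .step (l.getD t p)) (fun t => ⟨_, rfl⟩) p
    l.length (fun t _ => by simp) (fun s => ⟨max s l.length, le_max_left _ _, by simp⟩)
  refine ⟨t - l.length, v, ?_⟩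
  rw [← outputs_map_step]
  convert hv using 1
  refine List.ext_getElem (by simp; omega) ?_
  intro k h1 h2
  by_cases hk : k < l.length
  · simp [hk]
  · rw [List.getElem_map, List.getElem_append_right (not_lt.1 hk)]
    simp [hk]

theorem Solves.exists_canDecide (hA : A.Solves {e | ∃ i, e = .step i}) (l : List (Fin n))
    (p : Fin n) : ∃ v, A.CanDecide inp l v := by
  obtain ⟨m, v, h⟩ := hA.exists_solo (inp := inp) l p
  exact ⟨v, _, p, h⟩

/-- Running alone, `p` behaves alike after both schedules, so its decision is reachable from each.
-/
theorem Solves.canDecide_of_agree (hA : A.Solves {e | ∃ i, e = .step i}) {l l' : List (Fin n)}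
    {p : Fin n} (h : A.Agree p (A.steps inp (A.init inp) l) (A.steps inp (A.init inp) l')) :
    ∃ v, A.CanDecide inp l v ∧ A.CanDecide inp l' v := by
  obtain ⟨m, v, hv⟩ := hA.exists_solo (inp := inp) l p
  refine ⟨v, ⟨_, p, hv⟩, .replicate m p, p, ?_⟩
  rw [Decides, steps_append] at hv ⊢
  rw [← (h.replicate inp inp m).loc]
  exact hv

/-- A process that runs alone from the start decides on its own input. -/
theorem Solves.canDecide_input (hA : A.Solves {e | ∃ i, e = .step i}) (p : Fin n) :
    A.CanDecide inp [] (inp p) := by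
  obtain ⟨m, v, hv⟩ := hA.exists_solo (inp := fun _ => inp p) [] p
  have h : A.Agree p (A.init fun _ => inp p) (A.init inp) := ⟨rfl, rfl, rfl⟩
  obtain ⟨j, hj⟩ := hA.validity (fun _ => inp p) ((List.replicate m p).map .step) (by
    intro e he
    obtain ⟨i, -, rfl⟩ := List.mem_map.1 he
    exact ⟨i, rfl⟩) p v ((A.outputs_map_step _ _ _ _).2 hv)
  refine ⟨.replicate m p, p, ?_⟩
  rw [← hj, Decides, List.nil_append, ← (h.replicate _ inp m).loc]
  exact hv

/-- A bivalent schedule all of whose extensions by one step are univalent. -/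
theorem Solves.exists_critical (hA : A.Solves {e | ∃ i, e = .step i}) (h : A.Bivalent inp []) :
    ∃ l, A.Bivalent inp l ∧ ∀ i, ¬ A.Bivalent inp (l ++ [i]) := by
  by_contra! hcon
  choose f hf using hcon
  let g : ℕ → {l // A.Bivalent inp l} := fun t =>
    Nat.rec ⟨[], h⟩ (fun _ l => ⟨l.1 ++ [f l.1 l.2], hf l.1 l.2⟩) t
  let c : ℕ → Fin n := fun t => f (g t).1 (g t).2
  have hg : ∀ t, (List.ofFn fun k : Fin t => (Event.step (c k) : Event n)) = (g t).1.map .step := by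
    intro t
    induction t with
    | zero => rfl
    | succ t ih =>
      rw [List.ofFn_succ', List.concat_eq_append]
      change (List.ofFn fun k : Fin t => (Event.step (c k) : Event n)) ++ [.step (c t)] =
        ((g t).1 ++ [c t]).map .step
      rw [ih, List.map_append]
      rfl
  obtain ⟨p, hp⟩ : ∃ p, ∀ s, ∃ t, s ≤ t ∧ c t = p := by
    -- Pigeonhole: if each process had a time from which it is no longer scheduled, none could be
    -- scheduled at the maximum of these times.
    by_contra! hcon
    choose s hs using hcon
    exact hs (c (Finset.univ.sup s)) _ (Finset.le_sup (Finset.mem_univ _)) rfl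
  obtain ⟨t, v, -, hv⟩ := hA.waitFree inp (fun t => .step (c t)) (fun t => ⟨_, rfl⟩) p 0
    (fun t _ => by simp) (fun s => by
      obtain ⟨t, h1, h2⟩ := hp s
      exact ⟨t, h1, by rw [h2]⟩)
  rw [hg, outputs_map_step] at hv
  exact hA.not_bivalent hv (g t).2

end Valency

/-- If no process can tell in which order the next steps of `i` and `j` are taken, or that one of them is
not taken, then they access the same object. -/
theorem exists_invoke_of_not_agree (inp : Fin n → V) {C : A.Config} {i j : Fin n} (hij : i ≠ j)
    (hi : ∀ v, A.code i (C.loc i) ≠ .output v) (hj : ∀ v, A.code j (C.loc j) ≠ .output v)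
    (h1 : ¬ A.Agree j (A.steps inp C [i, j]) (A.steps inp C [j]))
    (h2 : ¬ A.Agree i (A.steps inp C [i]) (A.steps inp C [j, i]))
    (h3 : ¬ A.Agree i (A.steps inp C [i, j]) (A.steps inp C [j, i])) :
    ∃ o op cont op' cont', A.code i (C.loc i) = .invoke o op cont ∧
      A.code j (C.loc j) = .invoke o op' cont' := by
  classical
  simp only [steps_cons, steps_nil] at h1 h2 h3
  have li : (A.next inp C (.step j)).loc i = C.loc i :=
    A.next_loc_of_ne inp (by simpa using hij.symm) (by simp)
  have lj : (A.next inp C (.step i)).loc j = C.loc j :=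
    A.next_loc_of_ne inp (by simpa using hij) (by simp)
  rcases ci : A.code i (C.loc i) with ⟨o, op, cont⟩ | ⟨r, cont⟩ | ⟨r, x, cont⟩ | v <;>
    have ci' := ci <;> rw [← li] at ci'
  · rcases cj : A.code j (C.loc j) with ⟨o', op', cont'⟩ | ⟨r', cont'⟩ | ⟨r', x', cont'⟩ | v' <;>
      have cj' := cj <;> rw [← lj] at cj'
    · by_cases ho : o = o'
      · subst ho
        exact ⟨o, op, cont, op', cont', rfl, rfl⟩
      · refine absurd ?_ h3
        rw [A.next_of_invoke inp cj', A.next_of_invoke inp ci, A.next_of_invoke inp ci', A.next_of_invoke inp cj]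
        refine ⟨?_, rfl, ?_⟩
        · simp only [Function.update_of_ne ho, Function.update_of_ne (Ne.symm ho)]
          exact Function.update_comm ho _ _ _
        · simp [hij, ho]
    -- The read by `j` changes only the local state of `j`, so `i` cannot notice it.
    · exact absurd (Agree.step (A := A) (by
        rw [A.next_of_readReg inp cj]
        exact ⟨rfl, rfl, by simp [hij]⟩) inp inp) h2
    · refine absurd ?_ h3
      rw [A.next_of_writeReg inp cj', A.next_of_invoke inp ci, A.next_of_invoke inp ci', A.next_of_writeReg inp cj]
      exact ⟨rfl, rfl, by simp [hij]⟩
    · exact absurd cj (hj v')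
  · exact absurd (Agree.step (A := A) (by
      rw [A.next_of_readReg inp ci]
      exact ⟨rfl, rfl, by simp [hij.symm]⟩) inp inp) h1
  · rcases cj : A.code j (C.loc j) with ⟨o', op', cont'⟩ | ⟨r', cont'⟩ | ⟨r', x', cont'⟩ | v' <;>
      have cj' := cj <;> rw [← lj] at cj'
    · refine absurd ?_ h3
      rw [A.next_of_invoke inp cj', A.next_of_writeReg inp ci, A.next_of_writeReg inp ci', A.next_of_invoke inp cj]
      exact ⟨rfl, rfl, by simp [hij]⟩
    · exact absurd (Agree.step (A := A) (by
        rw [A.next_of_readReg inp cj]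
        exact ⟨rfl, rfl, by simp [hij]⟩) inp inp) h2
    · by_cases hr : r = r'
      · subst hr
        -- The write by `j` erases that of `i`.
        refine absurd ?_ h1
        rw [A.next_of_writeReg inp cj', A.next_of_writeReg inp ci,
          A.next_of_writeReg inp cj]
        exact ⟨rfl, by simp, by simp⟩
      · refine absurd ?_ h3
        rw [A.next_of_writeReg inp cj', A.next_of_writeReg inp ci, A.next_of_writeReg inp ci', A.next_of_writeReg inp cj]
        exact ⟨rfl, Function.update_comm hr _ _ _, by simp [hij]⟩
    · exact absurd cj (hj v')
  · exact absurd ci (hi v)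

/-- The effect of a schedule in which each process takes at most one step and accesses the object `o`. -/
theorem steps_invoke (inp : Fin n → V) {C : A.Config} {o : A.Obj} {op : Fin n → T.Op}
    {cont : Fin n → T.Resp → A.Loc} (h : ∀ i, A.code i (C.loc i) = .invoke o (op i) (cont i))
    {l : List (Fin n)} (hl : l.Nodup) :
    (A.steps inp C l).obj o = T.after op (C.obj o) l ∧
      (∀ o', o' ≠ o → (A.steps inp C l).obj o' = C.obj o') ∧ (A.steps inp C l).reg = C.reg := by
  induction l using List.reverseRecOn with
  | nil => exact ⟨rfl, fun _ _ => rfl, rfl⟩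
  | append_singleton l i ih =>
    rw [List.nodup_append] at hl
    have hi : i ∉ l := fun hi => hl.2.2 i hi i (by simp) rfl
    obtain ⟨h1, h2, h3⟩ := ih hl.1
    have hc := h i
    rw [← A.steps_loc (inp := inp) hi] at hc
    rw [steps_append, steps_cons, steps_nil, A.next_of_invoke inp hc]
    refine ⟨by simp [h1], fun o' ho => ?_, h3⟩
    simp [ho, h2 o' ho]

theorem steps_invoke_loc (inp : Fin n → V) {C : A.Config} {o : A.Obj} {op : Fin n → T.Op}
    {cont : Fin n → T.Resp → A.Loc} (h : ∀ i, A.code i (C.loc i) = .invoke o (op i) (cont i))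
    {s t : List (Fin n)} {p : Fin n} (hl : (s ++ p :: t).Nodup) :
    (A.steps inp C (s ++ p :: t)).loc p =
      cont p (T.apply (T.after op (C.obj o) s) (op p)).2 := by
  rw [List.nodup_append] at hl
  have hs : p ∉ s := fun hp => hl.2.2 p hp p (by simp) rfl
  have ht : p ∉ t := (List.nodup_cons.1 hl.2.1).1
  have hc := h p
  rw [← A.steps_loc (inp := inp) hs] at hc
  rw [steps_append, steps_cons, A.steps_loc ht, A.next_of_invoke inp hc]
  simp [(steps_invoke inp h hl.1).1]

/-- If consensus among at least two processes is solvable, then the type has the discerning property. -/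
theorem Solves.exists_discerning [Nontrivial V] (hA : A.Solves {e | ∃ i, e = .step i})
    (hn : 2 ≤ n) :
    ∃ (X Y : Finset (Fin n)) (q₀ : T.State) (op : Fin n → T.Op), X.Nonempty ∧ Y.Nonempty ∧
      Disjoint X Y ∧ X.card + Y.card = n ∧ Discerning T (· ∈ X) (· ∈ Y) q₀ op := by
  classical
  obtain ⟨v₀, v₁, hv⟩ := exists_pair_ne V
  let z : Fin n := ⟨0, by omega⟩
  -- A process running alone decides its own input, so two different inputs make the empty schedule
  -- bivalent.
  let inp : Fin n → V := fun i => if i = z then v₀ else v₁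
  have hbiv : A.Bivalent inp [] := by
    refine ⟨v₀, v₁, hv, ?_, ?_⟩
    · simpa [inp] using hA.canDecide_input (inp := inp) z
    · have h1 : inp ⟨1, by omega⟩ = v₁ := if_neg (by simp [z])
      rw [← h1]
      exact hA.canDecide_input _
  obtain ⟨l, ⟨v, w, hvw, hv', hw'⟩, hcrit⟩ := hA.exists_critical hbiv
  choose val hval using fun i => hA.exists_canDecide (inp := inp) (l ++ [i]) z
  have uniq : ∀ i u, A.CanDecide inp (l ++ [i]) u → u = val i := by
    intro i u hu
    by_contra hne
    exact hcrit i ⟨u, val i, hne, hu, hval i⟩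
  have noOutput : ∀ i u, ¬ A.Decides inp l i u := fun i u h =>
    hA.not_bivalent h ⟨v, w, hvw, hv', hw'⟩
  have first : ∀ u, A.CanDecide inp l u → ∃ i, val i = u := by
    rintro u ⟨l', p, h⟩
    rcases l' with _ | ⟨i, l'⟩
    · rw [List.append_nil] at h
      exact absurd h (noOutput p u)
    · refine ⟨i, (uniq i u ⟨l', p, ?_⟩).symm⟩
      simpa using h
  set C := A.steps inp (A.init inp) l with hC
  have conflict : ∀ i j p s t, val i ≠ val j →
      ¬ A.Agree p (A.steps inp C (i :: s)) (A.steps inp C (j :: t)) := by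
    intro i j p s t hne h
    rw [hC, ← steps_append, ← steps_append] at h
    obtain ⟨u, h1, h2⟩ := hA.canDecide_of_agree h
    rw [← List.singleton_append, ← List.append_assoc] at h1 h2
    exact hne ((uniq i u h1.of_append).symm.trans (uniq j u h2.of_append))
  have same : ∀ i j, val i ≠ val j → ∃ o op cont op' cont',
      A.code i (C.loc i) = .invoke o op cont ∧ A.code j (C.loc j) = .invoke o op' cont' := by
    intro i j hne
    refine exists_invoke_of_not_agree inp (fun h => hne (h ▸ rfl)) (noOutput i) (noOutput j)
      (conflict i j j [j] [] hne) (conflict i j i [] [i] hne) (conflict i j i [j] [i] hne)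
  obtain ⟨i₀, hi₀⟩ := first v hv'
  obtain ⟨j₀, hj₀⟩ := first w hw'
  obtain ⟨o, op₀, cont₀, op₁, cont₁, hc₀, hc₁⟩ := same i₀ j₀ (by rwa [hi₀, hj₀])
  have all : ∀ i, ∃ op cont, A.code i (C.loc i) = .invoke o op cont := by
    intro i
    -- Every `i` is in conflict with `j₀` or with `i₀`, which both access `o`.
    by_cases hi : val i = v
    · obtain ⟨o', op, cont, op', cont', h1, h2⟩ := same i j₀ (by rwa [hi, hj₀])
      rw [hc₁, Action.invoke.injEq] at h2
      exact ⟨op, cont, by rw [h1, h2.1]⟩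
    · obtain ⟨o', op, cont, op', cont', h1, h2⟩ := same i i₀ (by rwa [hi₀])
      rw [hc₀, Action.invoke.injEq] at h2
      exact ⟨op, cont, by rw [h1, h2.1]⟩
  choose op cont hcode using all
  -- There may be more than two values; all those other than `v` form the second team, as only
  -- values of opposite teams need to differ.
  refine ⟨Finset.univ.filter (val · = v), Finset.univ.filter (¬ val · = v), C.obj o, op, ⟨i₀, by simpa using hi₀⟩,
    ⟨j₀, by simpa [hj₀] using hvw.symm⟩, Finset.disjoint_filter_filter_not _ _ _, ?_, ?_⟩
  · rw [Finset.card_filter_add_card_filter_not]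
    simp
  · intro p s t s' t' h h' hresp hstate
    obtain ⟨hn, i, r, hr, hi⟩ := h
    obtain ⟨hn', j, r', hr', hj⟩ := h'
    simp only [Finset.mem_filter, Finset.mem_univ, true_and] at hi hj
    -- With equal responses and equal final states of `o`, process `p` has the same view after both
    -- schedules: the other objects and the registers are untouched.
    refine conflict i j p r r' (by rw [hi]; exact Ne.symm hj) ?_
    rw [← hr, ← hr']
    obtain ⟨a1, a2, a3⟩ := steps_invoke inp hcode hn
    obtain ⟨b1, b2, b3⟩ := steps_invoke inp hcode hn'
    refine ⟨?_, a3.trans b3.symm, ?_⟩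
    · funext o'
      by_cases ho : o' = o
      · subst ho
        rw [a1, b1, hstate]
      · rw [a2 o' ho, b2 o' ho]
    · rw [steps_invoke_loc inp hcode hn, steps_invoke_loc inp hcode hn', hresp]

end Algorithm

/-! ### The bounds on the recoverable consensus number -/

theorem ConsensusSolvable.rcSolvable {V : Type u} [Nontrivial V] {T : DetType.{u}}
    (hT : T.Readable) {m n : ℕ} (h : ConsensusSolvable V T m) (hmn : n + 2 ≤ m) :
    RCSolvable V T n := by
  obtain ⟨A, hA⟩ := h
  obtain ⟨X, Y, q₀, op, hX, hY, hXY, hc, hd⟩ := hA.exists_discerning (by omega)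
  rcases Nat.eq_zero_or_pos n with rfl | hn
  · exact rcSolvable_zero V T
  · have : Nonempty (Fin n) := ⟨⟨0, hn⟩⟩
    obtain ⟨B, hB⟩ := exists_solvesOn (V := V) hT (n := n) (fun P hP => by
      have hPn := card_finset_fin_le P
      obtain ⟨side, op', h1, h2, h3⟩ := hd.exists_recording hXY hX hY P hP (by omega)
      exact ⟨side, q₀, op', h1, h2, h3⟩) Finset.univ Finset.univ_nonempty
    rw [Finset.coe_univ] at hB
    exact ⟨B, hB.solves⟩

theorem RCSolvable.consensusSolvable {V : Type u} {T : DetType.{u}} {n : ℕ}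
    (h : RCSolvable V T n) : ConsensusSolvable V T n := by
  obtain ⟨A, hA⟩ := h
  exact ⟨A, fun inp es fs _ => hA.agreement inp es fs fun _ _ => trivial,
    fun inp es _ => hA.validity inp es fun _ _ => trivial,
    fun inp e _ => hA.waitFree inp e fun _ => trivial⟩

theorem rcons_le_cons (V : Type u) (T : DetType.{u}) : rcons V T ≤ cons V T :=
  iSup_mono fun _ => iSup_mono' fun h => ⟨h.consensusSolvable, le_rfl⟩

/-- If all solvable numbers were below `n`, the supremum would be at most `n - 1`; this also covers
`cons V T = ∞`. -/
theorem exists_consensusSolvable_of_le_cons {V : Type u} {T : DetType.{u}} {n : ℕ} (hn : 0 < n)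
    (h : (n : ℕ∞) ≤ cons V T) : ∃ m, n ≤ m ∧ ConsensusSolvable V T m := by
  by_contra! hcon
  have : cons V T ≤ ((n - 1 : ℕ) : ℕ∞) := by
    refine iSup₂_le fun m hm => ?_
    have : m < n := by
      by_contra hmn
      exact hcon m (not_lt.1 hmn) hm
    exact_mod_cast (by omega : m ≤ n - 1)
  have := h.trans this
  have : n ≤ n - 1 := by exact_mod_cast this
  omega

theorem rcSolvable_of_le_cons {V : Type u} [Nontrivial V] {T : DetType.{u}} (hT : T.Readable)
    {n : ℕ} (hn : 2 ≤ n) (h : (n : ℕ∞) ≤ cons V T) : RCSolvable V T (n - 2) := by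
  obtain ⟨m, hm, hs⟩ := exists_consensusSolvable_of_le_cons (by omega) h
  exact hs.rcSolvable hT (by omega)

theorem cons_sub_two_le_rcons {V : Type u} [Nontrivial V] {T : DetType.{u}} (hT : T.Readable) :
    cons V T - 2 ≤ rcons V T := by
  rw [tsub_le_iff_right]
  refine iSup₂_le fun m hm => ?_
  rcases lt_or_ge m 2 with h | h
  · exact le_trans (by exact_mod_cast h.le) le_add_self
  · have h1 : ((m - 2 : ℕ) : ℕ∞) ≤ rcons V T :=
      le_iSup₂_of_le (m - 2) (hm.rcSolvable hT (by omega)) le_rfl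
    calc (m : ℕ∞) = ((m - 2 : ℕ) : ℕ∞) + 2 := by exact_mod_cast (by omega : m = m - 2 + 2)
      _ ≤ _ := by gcongr

end RecoverableConsensus

theorem corollary5 (V : Type u) [Nontrivial V] (T : RecoverableConsensus.DetType.{u})
    (hT : T.Readable) :
    (∀ n : ℕ, 2 ≤ n → (n : ℕ∞) ≤ RecoverableConsensus.cons V T →
      RecoverableConsensus.RCSolvable V T (n - 2)) ∧
    RecoverableConsensus.cons V T - 2 ≤ RecoverableConsensus.rcons V T ∧
    RecoverableConsensus.rcons V T ≤ RecoverableConsensus.cons V T :=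
  ⟨fun _ hn h => RecoverableConsensus.rcSolvable_of_le_cons hT hn h,
    RecoverableConsensus.cons_sub_two_le_rcons hT, RecoverableConsensus.rcons_le_cons V T⟩
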